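/- Assume the Generalized Riemann Hypothesis: every zero $s$ of a Dirichlet $L$-function with $0<\Re s<1$ has $\Re s=\frac12$. Let $q$ be a positive integer and let $a,b$ be distinct reduced residue classes modulo $q$. For a Dirichlet character $\chi$ mod $q$ put $$b(\chi)=\sum_{\substack{\gamma\in\mathbb R\\ L(1/2+i\gamma,\chi)=0}}\frac1{\frac14+\gamma^2}$$ (zeros counted with multiplicity), and put $$V(q;a,b)=\sum_{\chi \bmod q}|\chi(b)-\chi(a)|^2\,b(\chi).$$ Let $\phi$ be Euler's function, $\Lambda$ the von Mangoldt function and $\gamma_0$ Euler's constant, and define $$\mathcal L(q)=\log q-\sum_{p\mid q}\frac{\log p}{p-1}+\frac{\Lambda(q)}{\phi(q)}-(\gamma_0+\log 2\pi),\qquad K_q(n)=\frac{\Lambda(q/(q,n))}{\phi(q/(q,n))}-\frac{\Lambda(q)}{\phi(q)},$$ where $p$ runs over primes and $(q,n)$ is the greatest common divisor; let $\iota_q(n)=1$ if $n\equiv1\pmod q$ and $\iota_q(n)=0$ otherwise. For a character $\chi$ mod $q$ let $\chi^*$ be the primitive character inducing $\chi$, let $\chi_0$ be the principal character mod $q$,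 and set $$M^*(q;a,b)=\sum_{\substack{\chi \bmod q\\ \chi\ne\chi_0}}|\chi(a)-\chi(b)|^2\,\frac{L'(1,\chi^*)}{L(1,\chi^*)}.$$ Then the series $b(\chi)$ converges for every $\chi$ mod $q$, and $$V(q;a,b)=2\phi(q)\big(\mathcal L(q)+K_q(a-b)+\iota_q(-ab^{-1})\log 2\big)+2M^*(q;a,b),$$ where $b^{-1}$ is the inverse of $b$ modulo $q$. -/

import Mathlib

open scoped ArithmeticFunction.vonMangoldt

noncomputable section

namespace PrimeRace

instance instNeZeroConductor {q : ℕ} [NeZero q] (χ : DirichletCharacter ℂ q) :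
    NeZero χ.conductor :=
  ⟨χ.conductor_ne_zero⟩

/-- The Generalized Riemann Hypothesis: every zero of every Dirichlet `L`-function in the open
critical strip (that is, every nontrivial zero) has real part `1/2`. -/
def GRH : Prop :=
  ∀ (N : ℕ) [NeZero N] (χ : DirichletCharacter ℂ N) (s : ℂ),
    χ.LFunction s = 0 → 0 < s.re → s.re < 1 → s.re = 1 / 2

/-- The point `1/2 + iγ` on the critical line. -/
def critPt (γ : ℝ) : ℂ := 1 / 2 + (γ : ℂ) * Complex.I

/-- The ordinates `γ`, as a set, of the zeros `1/2 + iγ` of `L(s, χ)` on the critical line. -/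
def ordinates {q : ℕ} [NeZero q] (χ : DirichletCharacter ℂ q) : Set ℝ :=
  {γ : ℝ | χ.LFunction (critPt γ) = 0}

/-- The contribution `m / (1/4 + γ²)` of a zero `1/2 + iγ` of `L(s, χ)` of multiplicity `m`. -/
def zeroTerm {q : ℕ} [NeZero q] (χ : DirichletCharacter ℂ q) (γ : ℝ) : ℝ :=
  (analyticOrderNatAt χ.LFunction (critPt γ) : ℝ) * (1 / (1 / 4 + γ ^ 2))

/-- `b(χ)`, the sum of `1 / (1/4 + γ²)` over the zeros `1/2 + iγ` of `L(s, χ)`, counted with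
multiplicity. -/
def bSum {q : ℕ} [NeZero q] (χ : DirichletCharacter ℂ q) : ℝ :=
  ∑' γ : ordinates χ, zeroTerm χ γ

/-- The variance `V(q; a, b)`. -/
def variance (q : ℕ) [NeZero q] (a b : (ZMod q)ˣ) : ℝ :=
  ∑ χ : DirichletCharacter ℂ q, ‖χ (b : ZMod q) - χ (a : ZMod q)‖ ^ 2 * bSum χ

/-- The arithmetic function `𝓛(q)`. -/
def calL (q : ℕ) : ℝ :=
  Real.log q - ∑ p ∈ q.primeFactors, Real.log p / ((p : ℝ) - 1) + Λ q / (Nat.totient q : ℝ)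
    - (Real.eulerMascheroniConstant + Real.log (2 * Real.pi))

/-- The characteristic function `ι_q` of the residue class `1` modulo `q`. -/
def iota (q : ℕ) (n : ZMod q) : ℝ := if n = 1 then 1 else 0

/-- The function `K_q`, on residue classes modulo `q`; it is evaluated at the least nonnegative
representative, and `gcd(q, n)` depends only on the class of `n`. -/
def K (q : ℕ) (n : ZMod q) : ℝ :=
  Λ (q / Nat.gcd q n.val) / (Nat.totient (q / Nat.gcd q n.val) : ℝ) - Λ q / (Nat.totient q : ℝ)

open Classical in
/-- `M*(q; a, b)`, a sum over the nonprincipal characters modulo `q`, where `χ*` is the primitive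
character that induces `χ`. -/
def MStar (q : ℕ) [NeZero q] (a b : (ZMod q)ˣ) : ℂ :=
  ∑ χ : DirichletCharacter ℂ q with χ ≠ 1,
    ((‖χ (a : ZMod q) - χ (b : ZMod q)‖ ^ 2 : ℝ) : ℂ) *
      (deriv χ.primitiveCharacter.LFunction 1 / χ.primitiveCharacter.LFunction 1)

end PrimeRace

end

/-! For nonprincipal `χ` the sum `b(χ)` has a closed form. Centre the completed L-function of the
primitive character `χ*` at `s = 1/2 + w`. Under GRH its zeros are the points `iγ`, and each
contributes `2 Re 1/(1/2 - iγ) = 1/(1/4 + γ²)` to `2 Re ξ'/ξ(1/2)`. Since `w = 1/2` is `s = 1`, that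
logarithmic derivative is explicit, and `b(χ) = log q* - γ₀ - log π - (1 + χ(-1)) log 2 + 2 Re
L'/L(1, χ*)`, where `q*` is the conductor.

The sum over zeros (`hasSum_zeros`) is obtained without Hadamard factorization. The zeros in `|w| <
R` are removed by Blaschke factors, and the zero-free quotient is written as `exp h`.
Borel–Carathéodory bounds `h'(1/2) - h'(0)` by `O(R^{3/2}/R²)`, because the function has order at
most `3/2`. The symmetry of `‖ξ‖` under `w ↦ -conj w` (the functional equation) forces `Re h'(0) =
0`. Letting `R → ∞` gives both convergence and value.

It remains to average over characters with weight `|χ(a) - χ(b)|² = 2 - 2 Re χ(ab⁻¹)`. The principal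
character has weight zero, so only convergence is needed for it. Orthogonality turns `χ(-1)` into
`ι_q`. For `log q*`, the identity `log q* = log q - ∑_{q* ∣ d ∣ q} Λ(q/d)` reduces matters to
orthogonality modulo each `d ∣ q` and to two divisor sums of `Λ(q/d) φ(d)`, which produce `𝓛` and
`K_q`. The map `χ ↦ χ⁻¹` shows that `M*` is real. -/

namespace PrimeRace

/-! ### Dividing out zeros, holomorphic logarithms, and a Borel–Carathéodory estimate -/

section Division

open Complex Metric Filter Topology ComplexConjugate

/-- An entire function can be divided by the factor `(w - z) ^ n` of a zero of order `n`. -/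
lemma exists_eq_pow_mul_of_analyticOrderAt {z : ℂ} (n : ℕ) {f : ℂ → ℂ} (hf : Differentiable ℂ f)
    (hn : analyticOrderAt f z = n) :
    ∃ g : ℂ → ℂ, Differentiable ℂ g ∧ g z ≠ 0 ∧ ∀ w, f w = (w - z) ^ n * g w := by
  induction n generalizing f with
  | zero =>
    refine ⟨f, hf, ?_, by simp⟩
    exact (hf.analyticAt z).analyticOrderAt_eq_zero.mp (by simpa using hn)
  | succ n ih =>
    have hfz : f z = 0 := by
      by_contra h
      rw [(hf.analyticAt z).analyticOrderAt_eq_zero.mpr h] at hn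
      exact absurd hn (by exact_mod_cast (Nat.succ_ne_zero n).symm)
    have hd : Differentiable ℂ (dslope f z) := by
      rw [← differentiableOn_univ] at hf ⊢
      exact (differentiableOn_dslope Filter.univ_mem).mpr hf
    have hmul : ∀ w, f w = (w - z) * dslope f z w := fun w ↦ by
      have := sub_smul_dslope f z w
      rw [hfz, sub_zero, smul_eq_mul] at this
      exact this.symm
    have hord : analyticOrderAt (dslope f z) z = n := by
      have h1 : f = (fun w ↦ w - z) * dslope f z := funext hmul
      have h2 : analyticOrderAt (fun w : ℂ ↦ w - z) z = 1 := by
        have := (show AnalyticAt ℂ (fun w : ℂ ↦ w - z) z by fun_prop).analyticOrderAt_eq_natCast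
          (n := 1)
        rw [Nat.cast_one] at this
        exact this.mpr ⟨fun _ ↦ 1, by fun_prop, by simp, by simp⟩
      rw [h1, analyticOrderAt_mul (by fun_prop) (hd.analyticAt z), h2] at hn
      rw [Nat.cast_succ, add_comm] at hn
      exact ENat.add_left_injective_of_ne_top (by simp) hn
    obtain ⟨g, hg, hgz, hg'⟩ := ih hd hord
    exact ⟨g, hg, hgz, fun w ↦ by rw [hmul, hg', pow_succ]; ring⟩

/-- Finitely many zeros of an entire function can be divided out. -/
lemma exists_eq_prod_mul {f : ℂ → ℂ} (hf : Differentiable ℂ f)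
    (hfin : ∀ z, analyticOrderAt f z ≠ ⊤) (s : Finset ℂ) :
    ∃ g : ℂ → ℂ, Differentiable ℂ g ∧ (∀ z ∈ s, g z ≠ 0) ∧
      ∀ w, f w = (∏ z ∈ s, (w - z) ^ analyticOrderNatAt f z) * g w := by
  classical
  induction s using Finset.induction_on with
  | empty => exact ⟨f, hf, by simp, by simp⟩
  | insert z s hz ih =>
    obtain ⟨g, hg, hgs, hfg⟩ := ih
    set P : ℂ → ℂ := fun w ↦ ∏ z ∈ s, (w - z) ^ analyticOrderNatAt f z with hP
    have hPd : Differentiable ℂ P := by fun_prop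
    have hPz : P z ≠ 0 := by
      refine Finset.prod_ne_zero_iff.mpr fun y hy ↦ pow_ne_zero _ (sub_ne_zero.mpr ?_)
      rintro rfl
      exact hz hy
    have hord : analyticOrderAt g z = analyticOrderNatAt f z := by
      have h1 : f = P * g := funext hfg
      rw [Nat.cast_analyticOrderNatAt (hfin z)]
      conv_rhs => rw [h1]
      rw [analyticOrderAt_mul (hPd.analyticAt z) (hg.analyticAt z),
        (hPd.analyticAt z).analyticOrderAt_eq_zero.mpr hPz, zero_add]
    obtain ⟨g', hg', hgz, hgg⟩ := exists_eq_pow_mul_of_analyticOrderAt _ hg hord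
    refine ⟨g', hg', ?_, fun w ↦ ?_⟩
    · intro y hy
      rcases Finset.mem_insert.mp hy with rfl | hy
      · exact hgz
      · have := hgs y hy
        rw [hgg] at this
        exact right_ne_zero_of_mul this
    · rw [hfg, hgg, Finset.prod_insert hz]
      ring

/-- A zero-free holomorphic function on a disc has a holomorphic logarithm. -/
lemma exists_exp_eq_on_ball {G : ℂ → ℂ} {R : ℝ} (hR : 0 < R) (hG : DifferentiableOn ℂ G (ball 0 R))
    (h0 : ∀ w ∈ ball (0 : ℂ) R, G w ≠ 0) :
    ∃ h : ℂ → ℂ, DifferentiableOn ℂ h (ball 0 R) ∧ ∀ w ∈ ball (0 : ℂ) R, G w = exp (h w) := by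
  have hG' : DifferentiableOn ℂ (deriv G) (ball 0 R) := hG.deriv isOpen_ball
  obtain ⟨k, hk⟩ := (hG'.div hG h0).isExactOn_ball
  have hmem : (0 : ℂ) ∈ ball (0 : ℂ) R := mem_ball_self hR
  have hconst : ∀ w ∈ ball (0 : ℂ) R, G w * exp (-k w) = G 0 * exp (-k 0) := by
    intro w hw
    have hder : ∀ x ∈ ball (0 : ℂ) R, HasDerivAt (fun w ↦ G w * exp (-k w)) 0 x := by
      intro x hx
      have h1 := (hG.differentiableAt (isOpen_ball.mem_nhds hx)).hasDerivAt
      have h2 := (hk x hx).neg.cexp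
      refine (h1.mul h2).congr_deriv ?_
      have := h0 x hx
      simp only [Pi.div_apply, Pi.neg_apply]
      field_simp
      ring
    refine (convex_ball (0 : ℂ) R).is_const_of_fderivWithin_eq_zero (𝕜 := ℂ)
      (fun x hx ↦ (hder x hx).differentiableAt.differentiableWithinAt) (fun x hx ↦ ?_) hw hmem
    rw [fderivWithin_of_isOpen isOpen_ball hx]
    ext
    simp [(hder x hx).deriv]
  refine ⟨fun w ↦ k w - k 0 + log (G 0), ?_, fun w hw ↦ ?_⟩
  · exact ((DifferentiableOn.sub (fun x hx ↦ (hk x hx).differentiableAt.differentiableWithinAt)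
      (differentiableOn_const _)).add (differentiableOn_const _))
  · have := hconst w hw
    rw [exp_add, exp_log (h0 0 hmem), exp_sub]
    rw [exp_neg, exp_neg] at this
    field_simp at this ⊢
    rw [this]

/-- A holomorphic function on a large disc whose real part is bounded above by `A` relative to
its value at `1/2` has nearly constant derivative near the origin. -/
lemma norm_deriv_sub_deriv_le {h : ℂ → ℂ} {R A : ℝ} (hR : 8 ≤ R) (hA : 0 < A)
    (hd : DifferentiableOn ℂ h (ball 0 R))
    (hre : ∀ w ∈ ball (0 : ℂ) R, (h w).re - (h (1 / 2)).re ≤ A) :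
    ‖deriv h (1 / 2) - deriv h 0‖ ≤ 1024 * A / R ^ 2 := by
  -- Borel–Carathéodory about `1/2` gives the bound `4A` on `|w| ≤ R/4`. Cauchy estimates on circles
  -- of radius `R/8` and then `R/32` bound `h''` by `4A · (8/R) · (32/R) = 1024 A/R²`.
  have hbc : ∀ w ∈ closedBall (0 : ℂ) (R / 4), ‖h w - h (1 / 2)‖ ≤ 4 * A := by
    intro w hw
    have hw' : ‖w‖ ≤ R / 4 := by simpa using hw
    set k : ℂ → ℂ := fun z ↦ h (1 / 2 + z) - h (1 / 2) with hk
    have hmaps : Set.MapsTo (fun z : ℂ ↦ 1 / 2 + z) (ball 0 (R - 1)) (ball 0 R) := by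
      intro z hz
      rw [mem_ball_zero_iff] at hz ⊢
      calc ‖1 / 2 + z‖ ≤ ‖(1 / 2 : ℂ)‖ + ‖z‖ := norm_add_le _ _
        _ < R := by norm_num; linarith
    have hnorm : ‖w - 1 / 2‖ ≤ R / 4 + 1 / 2 := by
      calc ‖w - 1 / 2‖ ≤ ‖w‖ + ‖(1 / 2 : ℂ)‖ := norm_sub_le _ _
        _ ≤ _ := by norm_num; linarith
    have := borelCaratheodory_zero (f := k) (R := R - 1) (z := w - 1 / 2) hA
      ((hd.comp (by fun_prop) hmaps).sub (differentiableOn_const _))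
      (fun z hz ↦ by simpa [hk] using hre _ (hmaps hz)) (by linarith)
      (by rw [mem_ball_zero_iff]; linarith) (by simp [hk])
    simp only [hk, add_sub_cancel] at this
    refine this.trans ?_
    rw [div_le_iff₀ (by linarith)]
    nlinarith
  have hd1 : ∀ w ∈ closedBall (0 : ℂ) (R / 8), ‖deriv h w‖ ≤ 32 * A / R := by
    intro w hw
    have hw' : ‖w‖ ≤ R / 8 := by simpa using hw
    have hsub : closedBall w (R / 8) ⊆ closedBall 0 (R / 4) := by
      refine closedBall_subset_closedBall' ?_
      rw [dist_zero_right]; linarith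
    have hsub' : closedBall (0 : ℂ) (R / 4) ⊆ ball 0 R := closedBall_subset_ball (by linarith)
    have := norm_deriv_le_of_forall_mem_sphere_norm_le (f := fun z ↦ h z - h (1 / 2)) (c := w)
      (R := R / 8) (C := 4 * A) (by linarith)
      (DifferentiableOn.diffContOnCl_ball (U := ball 0 R) (hd.sub (differentiableOn_const _))
        (hsub.trans hsub'))
      (fun z hz ↦ hbc z (hsub (sphere_subset_closedBall hz)))
    rw [deriv_sub_const] at this
    refine this.trans (le_of_eq ?_)
    field_simp; norm_num
  have hdd : DifferentiableOn ℂ (deriv h) (ball 0 R) := hd.deriv isOpen_ball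
  have hd2 : ∀ w ∈ closedBall (0 : ℂ) (1 / 2), ‖deriv (deriv h) w‖ ≤ 1024 * A / R ^ 2 := by
    intro w hw
    have hw' : ‖w‖ ≤ 1 / 2 := by simpa using hw
    have hsub : closedBall w (R / 32) ⊆ closedBall 0 (R / 8) := by
      refine closedBall_subset_closedBall' ?_
      rw [dist_zero_right]; linarith
    have hsub' : closedBall (0 : ℂ) (R / 8) ⊆ ball 0 R := closedBall_subset_ball (by linarith)
    have := norm_deriv_le_of_forall_mem_sphere_norm_le (f := deriv h) (c := w)
      (R := R / 32) (C := 32 * A / R) (by linarith)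
      (DifferentiableOn.diffContOnCl_ball (U := ball 0 R) hdd (hsub.trans hsub'))
      (fun z hz ↦ hd1 z (hsub (sphere_subset_closedBall hz)))
    refine this.trans (le_of_eq ?_)
    field_simp; norm_num
  have hsub' : closedBall (0 : ℂ) (1 / 2) ⊆ ball 0 R := closedBall_subset_ball (by linarith)
  have := (convex_closedBall (0 : ℂ) (1 / 2)).norm_image_sub_le_of_norm_deriv_le (f := deriv h)
    (fun x hx ↦ hdd.differentiableAt (isOpen_ball.mem_nhds (hsub' hx))) hd2
    (x := 0) (y := 1 / 2) (by simp) (by simp)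
  refine this.trans ?_
  have : 0 ≤ 1024 * A / R ^ 2 := by positivity
  norm_num at this ⊢
  linarith

end Division

/-! ### The sum over zeros as a logarithmic derivative -/

section SumOverZeros

open Complex Metric Filter Topology ComplexConjugate

/-- The quotient of the two sides is the Blaschke factor of the disc of radius `R` at `γi`. It has
modulus at most `1` in the disc and exactly `1` on the circle (next lemma). -/
lemma norm_sub_I_mul_le {R γ : ℝ} {w : ℂ} (hR : 0 < R) (hγ : |γ| ≤ R) (hw : ‖w‖ ≤ R) :
    ‖w - γ * I‖ ≤ ‖((R : ℂ) ^ 2 + γ * I * w) / R‖ := by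
  rw [norm_div, Complex.norm_real, Real.norm_of_nonneg hR.le, le_div_iff₀ hR,
    ← sq_le_sq₀ (by positivity) (by positivity), mul_pow, Complex.sq_norm, Complex.sq_norm,
    normSq_apply, normSq_apply]
  have h1 : w.re ^ 2 + w.im ^ 2 ≤ R ^ 2 := by
    have := (sq_le_sq₀ (norm_nonneg w) hR.le).mpr hw
    rw [Complex.sq_norm, normSq_apply] at this
    linarith
  have h2 : γ ^ 2 ≤ R ^ 2 := sq_le_sq.mpr (by rwa [abs_of_pos hR])
  simp [← ofReal_pow]
  nlinarith [mul_nonneg (sub_nonneg.mpr h1) (sub_nonneg.mpr h2)]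

lemma norm_sub_I_mul_eq {R γ : ℝ} {w : ℂ} (hR : 0 < R) (hw : ‖w‖ = R) :
    ‖((R : ℂ) ^ 2 + γ * I * w) / R‖ = ‖w - γ * I‖ := by
  rw [norm_div, Complex.norm_real, Real.norm_of_nonneg hR.le, div_eq_iff hR.ne',
    ← sq_eq_sq₀ (by positivity) (by positivity), mul_pow, Complex.sq_norm, Complex.sq_norm,
    normSq_apply, normSq_apply]
  have h1 : w.re ^ 2 + w.im ^ 2 = R ^ 2 := by
    rw [← hw, Complex.sq_norm, normSq_apply]; ring
  simp [← ofReal_pow]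
  linear_combination (γ ^ 2 - R ^ 2) * h1

lemma re_natCast_mul (n : ℕ) (z : ℂ) : ((n : ℂ) * z).re = n * z.re := by
  simp

lemma logDeriv_prod_pow {ι : Type*} {s : Finset ι} {L : ι → ℂ → ℂ} {m : ι → ℕ} {z : ℂ}
    (h0 : ∀ i ∈ s, L i z ≠ 0) (hd : ∀ i ∈ s, DifferentiableAt ℂ (L i) z) :
    logDeriv (fun w ↦ ∏ i ∈ s, L i w ^ m i) z = ∑ i ∈ s, (m i : ℂ) * logDeriv (L i) z := by
  have := logDeriv_prod (s := s) (f := fun i w ↦ L i w ^ m i) (x := z)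
    (fun i hi ↦ pow_ne_zero _ (h0 i hi)) (fun i hi ↦ (hd i hi).pow _)
  rw [this]
  exact Finset.sum_congr rfl fun i hi ↦ logDeriv_fun_pow (hd i hi) _

/-- If all zeros of the entire function `f` lie on the imaginary axis and `‖f‖` is symmetric about
this axis, then up to an error `O(A / R ^ 2)` the real part of `f' / f` at `1/2` is the sum of the
contributions of the zeros of modulus less than `R`. -/
lemma abs_two_mul_re_logDeriv_sub_sum_le {f : ℂ → ℂ} (hf : Differentiable ℂ f)
    (hzero : ∀ w, f w = 0 → w.re = 0) (hsymm : ∀ w, ‖f (-conj w)‖ = ‖f w‖)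
    {R A : ℝ} (hR : 8 ≤ R) (hA : 0 < A) (hbd : ∀ w, ‖w‖ = R → ‖f w‖ ≤ ‖f (1 / 2)‖ * Real.exp A)
    (s : Finset ℝ) (hs : ∀ γ : ℝ, γ ∈ s ↔ |γ| < R ∧ f (γ * I) = 0) :
    |2 * (logDeriv f (1 / 2)).re - ∑ γ ∈ s, (analyticOrderNatAt f (γ * I) : ℝ) *
      (1 / (1 / 4 + γ ^ 2) - γ ^ 2 / (R ^ 4 + γ ^ 2 / 4))| ≤ 2048 * A / R ^ 2 := by
  have hR0 : 0 < R := by linarith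
  have hhalf : f (1 / 2) ≠ 0 := fun h ↦ by simpa using hzero _ h
  have hfin : ∀ z, analyticOrderAt f z ≠ ⊤ := by
    intro z hz
    have := (hf.differentiableOn.analyticOnNhd isOpen_univ).eqOn_zero_of_preconnected_of_eventuallyEq_zero
      isPreconnected_univ (Set.mem_univ z) (analyticOrderAt_eq_top.mp hz)
    exact hhalf (this (Set.mem_univ _))
  have hinj : Function.Injective (fun γ : ℝ ↦ (γ : ℂ) * I) := fun x y h ↦ by
    simpa using h
  set m : ℝ → ℕ := fun γ ↦ analyticOrderNatAt f (γ * I) with hm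
  obtain ⟨g, hg, hgs, hfg⟩ := exists_eq_prod_mul hf hfin (s.map ⟨_, hinj⟩)
  simp only [Finset.prod_map, Function.Embedding.coeFn_mk, Finset.mem_map, forall_exists_index,
    and_imp, forall_apply_eq_imp_iff₂] at hfg hgs
  set P : ℂ → ℂ := fun w ↦ ∏ γ ∈ s, (w - γ * I) ^ m γ with hP
  set Q : ℂ → ℂ := fun w ↦ ∏ γ ∈ s, (((R : ℂ) ^ 2 + γ * I * w) / R) ^ m γ with hQ
  have hPd : Differentiable ℂ P := by fun_prop
  have hQd : Differentiable ℂ Q := by fun_prop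
  set G : ℂ → ℂ := fun w ↦ Q w * g w with hG
  have hGd : Differentiable ℂ G := hQd.mul hg
  have hfac : ∀ w, f w * Q w = G w * P w := fun w ↦ by rw [hfg]; simp only [hG, hP]; ring
  have hQfac : ∀ w ∈ ball (0 : ℂ) R, ∀ γ ∈ s, ((R : ℂ) ^ 2 + γ * I * w) / R ≠ 0 := by
    intro w hw γ hγ
    refine div_ne_zero (fun h ↦ ?_) (by exact_mod_cast hR0.ne')
    have h1 : ‖(γ : ℂ) * I * w‖ = R ^ 2 := by
      rw [eq_neg_of_add_eq_zero_right h, norm_neg, norm_pow, norm_real, Real.norm_of_nonneg hR0.le]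
    have h2 := ((hs γ).mp hγ).1
    have h3 : ‖w‖ < R := by simpa using hw
    rw [norm_mul, norm_mul, norm_I, mul_one, norm_real, Real.norm_eq_abs] at h1
    nlinarith [abs_nonneg γ, norm_nonneg w]
  have hQne : ∀ w ∈ ball (0 : ℂ) R, Q w ≠ 0 := fun w hw ↦
    Finset.prod_ne_zero_iff.mpr fun γ hγ ↦ pow_ne_zero _ (hQfac w hw γ hγ)
  have hGne : ∀ w ∈ ball (0 : ℂ) R, G w ≠ 0 := by
    intro w hw
    refine mul_ne_zero (hQne w hw) fun h ↦ ?_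
    have hfw : f w = 0 := by rw [hfg, h, mul_zero]
    have hre := hzero w hfw
    have hwI : w = (w.im : ℂ) * I := by
      apply Complex.ext <;> simp [hre]
    have hmem : w.im ∈ s := by
      rw [hs, ← hwI]
      exact ⟨(abs_im_le_norm w).trans_lt (by simpa using hw), hfw⟩
    exact hgs _ hmem (hwI ▸ h)
  have hPhalf : ∀ w : ℂ, w.re ≠ 0 → P w ≠ 0 := by
    intro w hw
    refine Finset.prod_ne_zero_iff.mpr fun γ hγ ↦ pow_ne_zero _ fun h ↦ hw ?_
    simpa using congrArg re h
  obtain ⟨h, hhd, hGh⟩ := exists_exp_eq_on_ball hR0 hGd.differentiableOn hGne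
  have hball : (1 / 2 : ℂ) ∈ ball (0 : ℂ) R := by
    rw [mem_ball_zero_iff]; norm_num; linarith
  have hball0 : (0 : ℂ) ∈ ball (0 : ℂ) R := mem_ball_self hR0
  have hGnorm : ∀ w ∈ ball (0 : ℂ) R, (h w).re = Real.log ‖G w‖ := fun w hw ↦ by
    rw [hGh w hw, norm_exp, Real.log_exp]
  -- Maximum principle: on the circle `‖P‖ = ‖Q‖`, hence `‖G‖ = ‖f‖`.
  have hGbd : ∀ w ∈ ball (0 : ℂ) R, ‖G w‖ ≤ ‖f (1 / 2)‖ * Real.exp A := by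
    intro w hw
    refine norm_le_of_forall_mem_frontier_norm_le isBounded_ball hGd.diffContOnCl ?_
      (subset_closure hw)
    intro z hz
    rw [frontier_ball _ hR0.ne', mem_sphere_zero_iff_norm] at hz
    refine le_trans (le_of_eq ?_) (hbd z hz)
    rw [hfg, hG, norm_mul, norm_mul, norm_prod, norm_prod]
    congr 1
    refine Finset.prod_congr rfl fun γ _ ↦ ?_
    rw [norm_pow, norm_pow, norm_sub_I_mul_eq hR0 hz]
  have hGhalf : ‖f (1 / 2)‖ ≤ ‖G (1 / 2)‖ := by
    rw [hfg, hG, norm_mul, norm_mul, norm_prod, norm_prod]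
    gcongr with γ hγ
    rw [norm_pow, norm_pow]
    gcongr
    exact norm_sub_I_mul_le hR0 ((hs γ).mp hγ).1.le (by norm_num; linarith)
  have hre : ∀ w ∈ ball (0 : ℂ) R, (h w).re - (h (1 / 2)).re ≤ A := by
    intro w hw
    rw [hGnorm w hw, hGnorm _ hball, ← Real.log_div (norm_ne_zero_iff.mpr (hGne w hw))
      (norm_ne_zero_iff.mpr (hGne _ hball)),
      Real.log_le_iff_le_exp (div_pos (norm_pos_iff.mpr (hGne w hw))
        (norm_pos_iff.mpr (hGne _ hball))), div_le_iff₀ (norm_pos_iff.mpr (hGne _ hball))]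
    calc ‖G w‖ ≤ ‖f (1 / 2)‖ * Real.exp A := hGbd w hw
      _ ≤ ‖G (1 / 2)‖ * Real.exp A := by gcongr
      _ = _ := mul_comm _ _
  have hmain := norm_deriv_sub_deriv_le hR hA hhd hre
  -- As all `γ` are real, `P` and `Q` inherit the symmetry of `‖f‖` about the imaginary axis. The
  -- point `x = 0`, where `P` may vanish, is trivial.
  have hGsymm : ∀ x : ℝ, ‖G (-x)‖ = ‖G x‖ := by
    intro x
    rcases eq_or_ne x 0 with rfl | hx
    · simp
    have e1 : ‖P (-x : ℂ)‖ = ‖P x‖ := by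
      simp only [hP, norm_prod, norm_pow]
      refine Finset.prod_congr rfl fun γ _ ↦ ?_
      rw [show (-x : ℂ) - γ * I = -conj ((x : ℂ) - γ * I) by simp; ring, norm_neg, norm_conj]
    have e2 : ‖Q (-x : ℂ)‖ = ‖Q x‖ := by
      simp only [hQ, norm_prod, norm_pow]
      refine Finset.prod_congr rfl fun γ _ ↦ ?_
      rw [show ((R : ℂ) ^ 2 + γ * I * (-x : ℂ)) / R = conj (((R : ℂ) ^ 2 + γ * I * x) / R) by simp,
        norm_conj]
    have e3 : ‖f (-x : ℂ)‖ = ‖f x‖ := by simpa using hsymm x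
    have h1 := congrArg norm (hfac x)
    have h2 := congrArg norm (hfac (-x))
    rw [norm_mul, norm_mul] at h1 h2
    rw [e1, e2, e3, h1] at h2
    exact (mul_right_cancel₀ (norm_ne_zero_iff.mpr (hPhalf x (by simpa using hx))) h2).symm
  -- `Re h = log ‖G‖` is even on the real axis, so its derivative at `0` vanishes.
  have hderiv0 : (deriv h 0).re = 0 := by
    have hd0 : HasDerivAt h (deriv h 0) ((0 : ℝ) : ℂ) := by
      simpa using (hhd.differentiableAt (isOpen_ball.mem_nhds hball0)).hasDerivAt
    have h1 := hd0.real_of_complex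
    have h2 : HasDerivAt (fun x : ℝ ↦ (h ((-x : ℝ) : ℂ)).re) (-(deriv h 0).re) 0 := by
      have := HasDerivAt.scomp (𝕜 := ℝ) (g₁ := fun x : ℝ ↦ (h (x : ℂ)).re) (h := fun x : ℝ ↦ -x)
        (0 : ℝ) (by simpa using h1) (hasDerivAt_neg _)
      simpa [Function.comp_def] using this
    have h3 : (fun x : ℝ ↦ (h ((-x : ℝ) : ℂ)).re) =ᶠ[𝓝 0] fun x : ℝ ↦ (h (x : ℂ)).re := by
      filter_upwards [ball_mem_nhds (0 : ℝ) hR0] with x hx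
      have hx' : |x| < R := by simpa using hx
      rw [hGnorm _ (by simpa using hx'), hGnorm _ (by simpa using hx')]
      push_cast
      rw [hGsymm]
    have h4 := (h2.congr_of_eventuallyEq h3.symm).unique h1
    linarith
  have hlog : logDeriv f (1 / 2) + logDeriv Q (1 / 2) = deriv h (1 / 2) + logDeriv P (1 / 2) := by
    have hP2 := hPhalf (1 / 2) (by norm_num)
    rw [← logDeriv_mul _ hhalf (hQne _ hball) hf.differentiableAt hQd.differentiableAt,
      show (fun z ↦ f z * Q z) = fun z ↦ G z * P z from funext hfac,
      logDeriv_mul _ (hGne _ hball) hP2 hGd.differentiableAt hPd.differentiableAt]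
    congr 1
    have : G =ᶠ[𝓝 (1 / 2)] fun w ↦ exp (h w) := by
      filter_upwards [isOpen_ball.mem_nhds hball] with w hw using hGh w hw
    rw [(logDeriv_congr_nhds this).eq_of_nhds, logDeriv_apply,
      (hhd.differentiableAt (isOpen_ball.mem_nhds hball)).hasDerivAt.cexp.deriv]
    field_simp
  have hlogP : (logDeriv P (1 / 2)).re = ∑ γ ∈ s, (m γ : ℝ) * ((1 / 2) / (1 / 4 + γ ^ 2)) := by
    rw [hP, logDeriv_prod_pow (fun γ _ h0 ↦ by simpa using congrArg re h0)
      (fun γ _ ↦ by fun_prop), re_sum]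
    refine Finset.sum_congr rfl fun γ _ ↦ ?_
    rw [logDeriv_apply, deriv_sub_const, deriv_id'', re_natCast_mul]
    congr 1
    rw [div_re, normSq_apply]
    simp
    field_simp
    ring
  have hlogQ : (logDeriv Q (1 / 2)).re =
      ∑ γ ∈ s, (m γ : ℝ) * ((γ ^ 2 / 2) / (R ^ 4 + γ ^ 2 / 4)) := by
    rw [hQ, logDeriv_prod_pow (L := fun (γ : ℝ) w ↦ ((R : ℂ) ^ 2 + γ * I * w) / R) (hQfac _ hball)
      (fun γ _ ↦ by fun_prop), re_sum]
    · refine Finset.sum_congr rfl fun γ _ ↦ ?_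
      rw [re_natCast_mul]
      congr 1
      have hd : HasDerivAt (fun w : ℂ ↦ ((R : ℂ) ^ 2 + γ * I * w) / R) (γ * I / R) (1 / 2) := by
        simpa using (((hasDerivAt_id (1 / 2 : ℂ)).const_mul (γ * I)).const_add ((R : ℂ) ^ 2)).div_const
          (R : ℂ)
      have hRc : (R : ℂ) ≠ 0 := by exact_mod_cast hR0.ne'
      rw [logDeriv_apply, hd.deriv, div_div_div_cancel_right₀ hRc, div_re, normSq_apply]
      simp [← ofReal_pow]
      field_simp
      ring
  have hre' := congrArg re hlog
  rw [add_re, add_re, hlogP, hlogQ] at hre'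
  have hsum : ∑ γ ∈ s, (m γ : ℝ) * (1 / (1 / 4 + γ ^ 2) - γ ^ 2 / (R ^ 4 + γ ^ 2 / 4)) =
      2 * ∑ γ ∈ s, (m γ : ℝ) * ((1 / 2) / (1 / 4 + γ ^ 2)) -
      2 * ∑ γ ∈ s, (m γ : ℝ) * ((γ ^ 2 / 2) / (R ^ 4 + γ ^ 2 / 4)) := by
    rw [Finset.mul_sum, Finset.mul_sum, ← Finset.sum_sub_distrib]
    exact Finset.sum_congr rfl fun γ _ ↦ by ring
  rw [hsum, show 2 * (logDeriv f (1 / 2)).re - (2 * ∑ γ ∈ s, (m γ : ℝ) * ((1 / 2) / (1 / 4 + γ ^ 2)) -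
      2 * ∑ γ ∈ s, (m γ : ℝ) * ((γ ^ 2 / 2) / (R ^ 4 + γ ^ 2 / 4))) =
      2 * (deriv h (1 / 2) - deriv h 0).re by rw [sub_re, hderiv0]; linarith, abs_mul, abs_two]
  calc 2 * |(deriv h (1 / 2) - deriv h 0).re| ≤ 2 * (1024 * A / R ^ 2) := by
        gcongr; exact (abs_re_le_norm _).trans hmain
    _ = _ := by ring

lemma finite_zeros_of_bounded {f : ℂ → ℂ} (hf : Differentiable ℂ f) {z : ℂ} (hz : f z ≠ 0) (R : ℝ) :
    {γ : ℝ | |γ| < R ∧ f (γ * I) = 0}.Finite := by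
  have h1 : (f ⁻¹' {0})ᶜ ∈ codiscrete ℂ :=
    (hf.differentiableOn.analyticOnNhd isOpen_univ).preimage_zero_mem_codiscrete hz
  obtain ⟨h2, h3⟩ := mem_codiscrete'.mp h1
  rw [compl_compl] at h3
  have h4 : (closedBall (0 : ℂ) R ∩ f ⁻¹' {0}).Finite :=
    ((isCompact_closedBall _ _).inter_right (isOpen_compl_iff.mp h2)).finite
      (h3.mono Set.inter_subset_right)
  have hinj : Function.Injective (fun γ : ℝ ↦ (γ : ℂ) * I) := fun x y h ↦ by
    simpa using h
  refine (h4.preimage hinj.injOn).subset fun γ hγ ↦ ⟨?_, hγ.2⟩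
  simpa using hγ.1.le

/-- **Sum over zeros.** Let `f` be an entire function of order at most `3/2`, with all zeros on the
imaginary axis and with `‖f‖` symmetric about it. The sum of `1 / (1/4 + γ ^ 2)` over its zeros
`γ * I`, counted with multiplicity, is twice the real part of `f' / f` at `1/2`. -/
theorem hasSum_zeros {f : ℂ → ℂ} (hf : Differentiable ℂ f)
    (hzero : ∀ w, f w = 0 → w.re = 0) (hsymm : ∀ w, ‖f (-conj w)‖ = ‖f w‖)
    {C : ℝ} (hC : ∀ w, ‖f w‖ ≤ Real.exp (C * (1 + ‖w‖) ^ (3 / 2 : ℝ))) :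
    HasSum (fun γ : {γ : ℝ | f (γ * I) = 0} ↦
      (analyticOrderNatAt f ((γ : ℝ) * I) : ℝ) * (1 / (1 / 4 + (γ : ℝ) ^ 2)))
      (2 * (logDeriv f (1 / 2)).re) := by
  classical
  have hhalf : f (1 / 2) ≠ 0 := fun h ↦ by simpa using hzero _ h
  set S := {γ : ℝ | f (γ * I) = 0} with hS
  set B := 2 * (logDeriv f (1 / 2)).re
  set m : ℝ → ℝ := fun γ ↦ analyticOrderNatAt f (γ * I) with hm
  set a : ℝ → ℝ := fun γ ↦ m γ * (1 / (1 / 4 + γ ^ 2)) with ha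
  -- The terms of the finite formula at radius `R`. They satisfy `0 ≤ t R γ ≤ a γ` and tend to `a
  -- γ`; nonnegativity for `|γ| < R` amounts to `γ⁴ ≤ R⁴`.
  set t : ℝ → ℝ → ℝ := fun R γ ↦ if |γ| < R then
    m γ * (1 / (1 / 4 + γ ^ 2) - γ ^ 2 / (R ^ 4 + γ ^ 2 / 4)) else 0 with ht
  have hm0 : ∀ γ, 0 ≤ m γ := fun γ ↦ Nat.cast_nonneg _
  have ha0 : ∀ γ, 0 ≤ a γ := fun γ ↦ mul_nonneg (hm0 γ) (by positivity)
  have ht0 : ∀ R γ, 0 ≤ t R γ := by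
    intro R γ
    simp only [ht]
    split_ifs with h
    · refine mul_nonneg (hm0 γ) (sub_nonneg.mpr ?_)
      have hR : 0 < R := (abs_nonneg γ).trans_lt h
      rw [div_le_div_iff₀ (by positivity) (by positivity)]
      have h2 : γ ^ 2 ≤ R ^ 2 := sq_le_sq.mpr (by rw [abs_of_pos hR]; exact h.le)
      nlinarith [sq_nonneg γ, sq_nonneg R]
    · exact le_rfl
  have hta : ∀ R γ, t R γ ≤ a γ := by
    intro R γ
    simp only [ht]
    split_ifs with h
    · refine mul_le_mul_of_nonneg_left (sub_le_self _ (by positivity)) (hm0 γ)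
    · exact ha0 γ
  have htlim : ∀ γ, Tendsto (fun R ↦ t R γ) atTop (𝓝 (a γ)) := by
    intro γ
    have h1 : Tendsto (fun R : ℝ ↦ m γ * (1 / (1 / 4 + γ ^ 2) - γ ^ 2 / (R ^ 4 + γ ^ 2 / 4))) atTop
        (𝓝 (m γ * (1 / (1 / 4 + γ ^ 2) - 0))) := by
      refine (tendsto_const_nhds.sub ?_).const_mul _
      refine tendsto_const_nhds.div_atTop ?_
      exact tendsto_atTop_add_const_right _ _ (tendsto_pow_atTop (by norm_num))
    rw [sub_zero] at h1
    refine h1.congr' ?_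
    filter_upwards [eventually_gt_atTop |γ|] with R hR
    simp [ht, hR]
  -- For `R ≥ 8`, `1 + R ≤ 2R` accounts for the first term and normalization by `‖f (1/2)‖` for the
  -- second; the `1` makes `K` positive.
  set K : ℝ := |C| * 2 ^ (3 / 2 : ℝ) + |Real.log ‖f (1 / 2)‖| + 1 with hK
  have hKpos : 0 < K := by positivity
  have hsumt : ∀ R, 8 ≤ R → Summable (fun γ : S ↦ t R γ) ∧
      |B - ∑' γ : S, t R γ| ≤ 2048 * K * R ^ (-(1 / 2) : ℝ) := by
    intro R hR
    have hR0 : 0 < R := by linarith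
    set s := (finite_zeros_of_bounded hf hhalf R).toFinset with hs
    have hmem : ∀ γ, γ ∈ s ↔ |γ| < R ∧ f (γ * I) = 0 := fun γ ↦ by simp [hs]
    have hbd : ∀ w, ‖w‖ = R → ‖f w‖ ≤ ‖f (1 / 2)‖ * Real.exp (K * R ^ (3 / 2 : ℝ)) := by
      intro w hw
      refine (hC w).trans ?_
      nth_rewrite 1 [← Real.exp_log (norm_pos_iff.mpr hhalf)]
      rw [← Real.exp_add]
      refine Real.exp_le_exp.mpr ?_
      have h1 : (1 + ‖w‖) ^ (3 / 2 : ℝ) ≤ 2 ^ (3 / 2 : ℝ) * R ^ (3 / 2 : ℝ) := by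
        rw [← Real.mul_rpow (by norm_num) hR0.le]
        gcongr
        rw [hw]; linarith
      have h2 : 1 ≤ R ^ (3 / 2 : ℝ) := Real.one_le_rpow (by linarith) (by norm_num)
      have h3 : C * (1 + ‖w‖) ^ (3 / 2 : ℝ) ≤ |C| * (2 ^ (3 / 2 : ℝ) * R ^ (3 / 2 : ℝ)) :=
        mul_le_mul (le_abs_self C) h1 (by positivity) (abs_nonneg C)
      have h4 := neg_abs_le (Real.log ‖f (1 / 2)‖)
      have h5 : |Real.log ‖f (1 / 2)‖| ≤ |Real.log ‖f (1 / 2)‖| * R ^ (3 / 2 : ℝ) :=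
        le_mul_of_one_le_right (abs_nonneg _) h2
      rw [hK]
      nlinarith
    have key := abs_two_mul_re_logDeriv_sub_sum_le hf hzero hsymm hR
      (mul_pos hKpos (Real.rpow_pos_of_pos hR0 _)) hbd s hmem
    have hss : HasSum (fun γ : S ↦ t R γ) (∑ γ ∈ s, t R γ) := by
      have h1 : HasSum (fun γ : S ↦ t R γ)
          (∑ γ ∈ s.subtype (· ∈ S), t R γ) := by
        refine hasSum_sum_of_ne_finset_zero fun γ hγ ↦ ?_
        simp only [ht]
        refine if_neg fun h ↦ hγ ?_
        rw [Finset.mem_subtype, hmem]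
        exact ⟨h, γ.2⟩
      rwa [Finset.sum_subtype_of_mem (f := fun γ ↦ t R γ) (p := (· ∈ S))
        fun γ hγ ↦ ((hmem γ).mp hγ).2] at h1
    refine ⟨hss.summable, ?_⟩
    rw [hss.tsum_eq]
    have e1 : ∑ γ ∈ s, t R γ = ∑ γ ∈ s, (analyticOrderNatAt f (γ * I) : ℝ) *
        (1 / (1 / 4 + γ ^ 2) - γ ^ 2 / (R ^ 4 + γ ^ 2 / 4)) :=
      Finset.sum_congr rfl fun γ hγ ↦ if_pos ((hmem γ).mp hγ).1
    rw [e1]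
    refine key.trans (le_of_eq ?_)
    rw [show (-(1 / 2) : ℝ) = 3 / 2 - (2 : ℕ) by norm_num, Real.rpow_sub_natCast hR0.ne']
    ring
  have herr : Tendsto (fun R : ℝ ↦ 2048 * K * R ^ (-(1 / 2) : ℝ)) atTop (𝓝 0) := by
    simpa using (tendsto_rpow_neg_atTop (y := 1 / 2) (by norm_num)).const_mul (2048 * K)
  have htsum : Tendsto (fun R ↦ ∑' γ : S, t R γ) atTop (𝓝 B) := by
    rw [tendsto_iff_norm_sub_tendsto_zero]
    refine squeeze_zero' (.of_forall fun _ ↦ norm_nonneg _) ?_ herr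
    filter_upwards [eventually_ge_atTop 8] with R hR
    rw [norm_sub_rev]
    exact (hsumt R hR).2
  -- A finite sum of the `a γ` is the limit of the corresponding sums of `t R γ`, each at most the
  -- full sum over `γ`, which tends to `B`.
  have hsummable : Summable (fun γ : S ↦ a γ) := by
    refine summable_of_sum_le (c := B) (fun γ ↦ ha0 γ) fun u ↦ ?_
    refine le_of_tendsto_of_tendsto (tendsto_finsetSum u fun γ _ ↦ htlim γ) htsum ?_
    filter_upwards [eventually_ge_atTop 8] with R hR
    exact (hsumt R hR).1.sum_le_tsum u fun γ _ ↦ ht0 R γ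
  have hdom : Tendsto (fun R ↦ ∑' γ : S, t R γ) atTop (𝓝 (∑' γ : S, a γ)) := by
    refine tendsto_tsum_of_dominated_convergence hsummable (fun γ ↦ htlim γ) (.of_forall fun R γ ↦ ?_)
    rw [Real.norm_of_nonneg (ht0 R γ)]
    exact hta R γ
  have := tendsto_nhds_unique hdom htsum
  exact this ▸ hsummable.hasSum

end SumOverZeros

/-! ### Growth of completed L-functions -/

section Growth

open Complex Metric Filter Topology ComplexConjugate Set MeasureTheory

/-- The entire function attached to a weak functional equation pair is bounded on vertical
strips. -/
lemma exists_norm_Λ₀_le (P : WeakFEPair ℂ) (a b : ℝ) :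
    ∃ C, ∀ s : ℂ, a ≤ s.re → s.re ≤ b → ‖P.Λ₀ s‖ ≤ C := by
  have hconv : ∀ σ : ℝ, IntegrableOn (fun t : ℝ ↦ ‖P.f_modif t‖ * t ^ (σ - 1)) (Ioi 0) := by
    intro σ
    have h := (P.isStrongFEPair_toStrongFEPair.hasMellin σ).1.norm
    refine IntegrableOn.congr_fun h (fun t ht ↦ ?_) measurableSet_Ioi
    simp only [norm_smul]
    rw [norm_cpow_eq_rpow_re_of_pos ht, mul_comm]
    simp [WeakFEPair.toStrongFEPair]
  refine ⟨∫ t in Ioi 0, (‖P.f_modif t‖ * t ^ (a - 1) + ‖P.f_modif t‖ * t ^ (b - 1)),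
    fun s ha hb ↦ ?_⟩
  refine norm_integral_le_of_norm_le ((hconv a).add (hconv b)) ?_
  filter_upwards [ae_restrict_mem measurableSet_Ioi] with t ht
  have ht0 : (0 : ℝ) < t := ht
  rw [norm_smul, norm_cpow_eq_rpow_re_of_pos ht, mul_comm, ← mul_add]
  gcongr
  rw [sub_re, one_re]
  -- `t ^ (Re s - 1)` is at most `t ^ (b - 1)` for `t ≥ 1` and at most `t ^ (a - 1)` for `t ≤ 1`.
  rcases le_total 1 t with h1 | h1
  · have := Real.rpow_le_rpow_of_exponent_le h1 (show s.re - 1 ≤ b - 1 by linarith)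
    have := Real.rpow_pos_of_pos ht0 (a - 1)
    linarith
  · have := Real.rpow_le_rpow_of_exponent_ge ht0 h1 (show a - 1 ≤ s.re - 1 by linarith)
    have := Real.rpow_pos_of_pos ht0 (b - 1)
    linarith

/-- The function is `N ^ (-s)` times a combination of Hurwitz functions, which are values of `Λ₀` at
`s/2` (even part) and `(s + 1)/2` (odd part). The condition `0 ≤ a` ensures `‖N ^ (-s)‖ ≤ 1`. -/
lemma exists_norm_completedLFunction₀_le {N : ℕ} [NeZero N] (Φ : ZMod N → ℂ) {a b : ℝ} (ha : 0 ≤ a) :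
    ∃ C, ∀ s : ℂ, a ≤ s.re → s.re ≤ b → ‖ZMod.completedLFunction₀ Φ s‖ ≤ C := by
  choose C₁ hC₁ using fun j : ZMod N ↦
    exists_norm_Λ₀_le (HurwitzZeta.hurwitzEvenFEPair (ZMod.toAddCircle j)) (a / 2) (b / 2)
  choose C₂ hC₂ using fun j : ZMod N ↦
    exists_norm_Λ₀_le (HurwitzZeta.hurwitzOddFEPair (ZMod.toAddCircle j)) ((a + 1) / 2) ((b + 1) / 2)
  refine ⟨∑ j, ‖Φ j‖ * (C₁ j / 2) + ∑ j, ‖Φ j‖ * (C₂ j / 2), fun s h1 h2 ↦ ?_⟩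
  have hN : ‖(N : ℂ) ^ (-s)‖ ≤ 1 := by
    rw [norm_natCast_cpow_of_pos (NeZero.pos N), neg_re]
    exact Real.rpow_le_one_of_one_le_of_nonpos (by exact_mod_cast NeZero.one_le) (by linarith)
  refine (norm_add_le _ _).trans (add_le_add ?_ ?_)
  · rw [norm_mul]
    refine (mul_le_of_le_one_left (norm_nonneg _) hN).trans ((norm_sum_le _ _).trans ?_)
    gcongr with j
    rw [norm_mul, HurwitzZeta.completedHurwitzZetaEven₀, norm_div, norm_ofNat]
    gcongr
    apply hC₁ <;> rw [show s / 2 = s / (2 : ℝ) by simp, div_ofReal_re] <;> linarith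
  · rw [norm_mul]
    refine (mul_le_of_le_one_left (norm_nonneg _) hN).trans ((norm_sum_le _ _).trans ?_)
    gcongr with j
    rw [norm_mul, HurwitzZeta.completedHurwitzZetaOdd, norm_div, norm_ofNat]
    gcongr
    -- The odd pair has no polar terms.
    have : (HurwitzZeta.hurwitzOddFEPair (ZMod.toAddCircle j)).Λ ((s + 1) / 2) =
        (HurwitzZeta.hurwitzOddFEPair (ZMod.toAddCircle j)).Λ₀ ((s + 1) / 2) := by
      rw [WeakFEPair.Λ₀_eq]
      simp [HurwitzZeta.hurwitzOddFEPair]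
    rw [this]
    apply hC₂ <;> rw [show (s + 1) / 2 = (s + 1) / (2 : ℝ) by simp, div_ofReal_re, add_re, one_re] <;> linarith

lemma norm_Gamma_le_Gamma_re {s : ℂ} (hs : 0 < s.re) : ‖Gamma s‖ ≤ Real.Gamma s.re := by
  rw [Gamma_eq_integral hs, Real.Gamma_eq_integral hs, GammaIntegral]
  refine norm_integral_le_of_norm_le (Real.GammaIntegral_convergent hs) ?_
  filter_upwards [ae_restrict_mem measurableSet_Ioi] with t ht
  rw [norm_mul, norm_cpow_eq_rpow_re_of_pos ht, norm_real, Real.norm_of_nonneg (Real.exp_pos _).le]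
  simp

/-- A crude substitute for Stirling: `Γ(x) ≤ n! ≤ n ^ n` with `n = ⌈x⌉`, and `log y ≤ 2 √y`. This is
the source of the exponent `3/2`; the argument over zeros only needs an exponent below `2`. -/
lemma Gamma_le_exp {x : ℝ} (hx : 2 ≤ x) : Real.Gamma x ≤ Real.exp (2 * (1 + x) ^ (3 / 2 : ℝ)) := by
  set n := ⌈x⌉₊ with hn
  have h1 : x ≤ n := Nat.le_ceil x
  have h2 : (n : ℝ) < x + 1 := Nat.ceil_lt_add_one (by linarith)
  have hpos : 0 < 1 + x := by linarith
  calc Real.Gamma x ≤ Real.Gamma (n + 1) :=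
        Real.Gamma_strictMonoOn_Ici.monotoneOn (by simpa using hx) (by simp; linarith) (by linarith)
    _ = (n.factorial : ℝ) := Real.Gamma_nat_eq_factorial n
    _ ≤ (n : ℝ) ^ n := by exact_mod_cast Nat.factorial_le_pow n
    _ ≤ (1 + x) ^ n := by gcongr; linarith
    _ = Real.exp (n * Real.log (1 + x)) := by
        rw [mul_comm, Real.exp_mul, Real.exp_log hpos, Real.rpow_natCast]
    _ ≤ Real.exp ((1 + x) * (2 * (1 + x) ^ (1 / 2 : ℝ))) := by
        have h3 := Real.log_le_rpow_div hpos.le (show (0 : ℝ) < 1 / 2 by norm_num)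
        have h4 : 0 ≤ Real.log (1 + x) := Real.log_nonneg (by linarith)
        gcongr
        · linarith
        · linarith
    _ = _ := by
        congr 1
        rw [show (3 / 2 : ℝ) = 1 + 1 / 2 by norm_num, Real.rpow_add hpos, Real.rpow_one]
        ring

lemma norm_Gammaℝ_le {s : ℂ} (hs : 4 ≤ s.re) :
    ‖Gammaℝ s‖ ≤ Real.exp (2 * (1 + ‖s‖) ^ (3 / 2 : ℝ)) := by
  have hre : (s / 2).re = s.re / 2 := by rw [show s / 2 = s / (2 : ℝ) by simp, div_ofReal_re]
  have h1 : ‖(Real.pi : ℂ) ^ (-s / 2)‖ ≤ 1 := by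
    rw [norm_cpow_eq_rpow_re_of_pos Real.pi_pos]
    refine Real.rpow_le_one_of_one_le_of_nonpos (by linarith [Real.pi_gt_three]) ?_
    rw [neg_div, neg_re, hre]; linarith
  rw [Gammaℝ_def, norm_mul]
  refine (mul_le_of_le_one_left (norm_nonneg _) h1).trans ?_
  refine (norm_Gamma_le_Gamma_re (by rw [hre]; linarith)).trans ?_
  rw [hre]
  refine (Gamma_le_exp (by linarith)).trans (Real.exp_le_exp.mpr ?_)
  have := re_le_norm s
  gcongr
  linarith

lemma exists_norm_LFunction_le {N : ℕ} [NeZero N] (χ : DirichletCharacter ℂ N) :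
    ∃ C, ∀ s : ℂ, 4 ≤ s.re → ‖χ.LFunction s‖ ≤ C := by
  have hs2 : Summable fun n ↦ ‖LSeries.term (fun n ↦ χ n) 2 n‖ :=
    (ZMod.LSeriesSummable_of_one_lt_re χ (s := 2) (by norm_num)).norm
  refine ⟨∑' n, ‖LSeries.term (fun n ↦ χ n) 2 n‖, fun s hs ↦ ?_⟩
  rw [DirichletCharacter.LFunction_eq_LSeries χ (by linarith)]
  refine tsum_of_norm_bounded hs2.hasSum fun n ↦ ?_
  refine LSeries.norm_term_le_of_re_le_re _ (by norm_num; linarith) n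

end Growth

/-! ### Complex conjugation and the order of growth -/

section Conjugation

open Complex Metric Filter Topology ComplexConjugate

/-- Identity theorem: `conj ∘ f ∘ conj` is entire and agrees with `g` near `2`. -/
lemma conj_eq_of_conj_eq_of_one_lt_re {f g : ℂ → ℂ} (hf : Differentiable ℂ f)
    (hg : Differentiable ℂ g) (hfg : ∀ s : ℂ, 1 < s.re → g (conj s) = conj (f s)) (s : ℂ) :
    g (conj s) = conj (f s) := by
  have hd : Differentiable ℂ (conj ∘ f ∘ conj) := fun z ↦ by
    have := (hf (conj z)).hasDerivAt.conj_conj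
    rw [Complex.conj_conj] at this
    exact this.differentiableAt
  have heq : g = conj ∘ f ∘ conj := by
    refine (hg.differentiableOn.analyticOnNhd isOpen_univ).eq_of_eventuallyEq
      (hd.differentiableOn.analyticOnNhd isOpen_univ) (z₀ := 2) ?_
    filter_upwards [(isOpen_lt continuous_const continuous_re).mem_nhds
      (show (1 : ℝ) < (2 : ℂ).re by norm_num)] with z hz
    have := hfg (conj z) (by simpa using hz)
    simpa using this
  simp [heq]

lemma natCast_cpow_conj (n : ℕ) (s : ℂ) : (n : ℂ) ^ conj s = conj ((n : ℂ) ^ s) := by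
  rw [cpow_conj _ _ (by rw [natCast_arg]; exact Real.pi_ne_zero.symm), conj_natCast]

lemma Gammaℝ_conj (s : ℂ) : Gammaℝ (conj s) = conj (Gammaℝ s) := by
  rw [Gammaℝ_def, Gammaℝ_def, map_mul, ← Gamma_conj, map_div₀, conj_ofNat,
    show -conj s / 2 = conj (-s / 2) by rw [map_div₀, map_neg, conj_ofNat], cpow_conj _ _
      (by rw [arg_ofReal_of_nonneg Real.pi_pos.le]; exact Real.pi_ne_zero.symm), conj_ofReal]

lemma even_inv_iff {N : ℕ} (χ : DirichletCharacter ℂ N) : χ⁻¹.Even ↔ χ.Even := by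
  rw [DirichletCharacter.Even, DirichletCharacter.Even, ← MulChar.star_apply' χ,
    RCLike.star_def, map_eq_one_iff _ (RingHom.injective _)]

lemma gammaFactor_inv_conj {N : ℕ} (χ : DirichletCharacter ℂ N) (s : ℂ) :
    χ⁻¹.gammaFactor (conj s) = conj (χ.gammaFactor s) := by
  by_cases h : χ.Even
  · rw [h.gammaFactor_def, ((even_inv_iff χ).mpr h).gammaFactor_def, Gammaℝ_conj]
  · rw [DirichletCharacter.gammaFactor, DirichletCharacter.gammaFactor, if_neg h,
      if_neg (mt (even_inv_iff χ).mp h), ← Gammaℝ_conj, map_add, map_one]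

lemma gammaFactor_ne_zero {N : ℕ} (χ : DirichletCharacter ℂ N) {s : ℂ} (hs : 0 < s.re) :
    χ.gammaFactor s ≠ 0 := by
  rw [DirichletCharacter.gammaFactor]
  split_ifs
  · exact Gammaℝ_ne_zero_of_re_pos hs
  · exact Gammaℝ_ne_zero_of_re_pos (by rw [add_re, one_re]; linarith)

section Conj

variable {N : ℕ} [NeZero N] (χ : DirichletCharacter ℂ N)

lemma LFunction_inv_conj_of_one_lt_re {s : ℂ} (hs : 1 < s.re) :
    χ⁻¹.LFunction (conj s) = conj (χ.LFunction s) := by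
  rw [DirichletCharacter.LFunction_eq_LSeries _ hs,
    DirichletCharacter.LFunction_eq_LSeries _ (by simpa using hs), LSeries, LSeries, conj_tsum]
  refine tsum_congr fun n ↦ ?_
  rw [LSeries.term_def, LSeries.term_def]
  split_ifs
  · simp
  · rw [map_div₀, natCast_cpow_conj, ← MulChar.star_apply' χ, RCLike.star_def]

lemma completedLFunction_eq_mul {s : ℂ} (hs : 0 < s.re) :
    χ.completedLFunction s = χ.LFunction s * χ.gammaFactor s := by
  rw [DirichletCharacter.LFunction_eq_completed_div_gammaFactor χ s
    (.inl (by rintro rfl; simp at hs)), div_mul_cancel₀ _ (gammaFactor_ne_zero χ hs)]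

variable {χ}

lemma LFunction_inv_conj (hχ : χ ≠ 1) (s : ℂ) :
    χ⁻¹.LFunction (conj s) = conj (χ.LFunction s) :=
  conj_eq_of_conj_eq_of_one_lt_re (DirichletCharacter.differentiable_LFunction hχ)
    (DirichletCharacter.differentiable_LFunction (inv_ne_one.mpr hχ))
    (fun _ hs ↦ LFunction_inv_conj_of_one_lt_re χ hs) s

lemma completedLFunction_inv_conj (hχ : χ ≠ 1) (s : ℂ) :
    χ⁻¹.completedLFunction (conj s) = conj (χ.completedLFunction s) := by
  refine conj_eq_of_conj_eq_of_one_lt_re (DirichletCharacter.differentiable_completedLFunction hχ)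
    (DirichletCharacter.differentiable_completedLFunction (inv_ne_one.mpr hχ)) (fun s hs ↦ ?_) s
  rw [completedLFunction_eq_mul χ (by linarith), completedLFunction_eq_mul χ⁻¹
    (by rw [conj_re]; linarith), LFunction_inv_conj_of_one_lt_re χ hs, gammaFactor_inv_conj, map_mul]

end Conj

/-- Follows from the trivial character modulo `1`, as the polar terms `1/s` and `1/(1 - s)` commute
with conjugation. -/
lemma completedRiemannZeta₀_conj (s : ℂ) :
    completedRiemannZeta₀ (conj s) = conj (completedRiemannZeta₀ s) := by
  refine conj_eq_of_conj_eq_of_one_lt_re differentiable_completedZeta₀ differentiable_completedZeta₀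
    (fun s hs ↦ ?_) s
  have h := completedLFunction_eq_mul (1 : DirichletCharacter ℂ 1) (s := s) (by linarith)
  have h' := completedLFunction_eq_mul (1 : DirichletCharacter ℂ 1)⁻¹ (s := conj s)
    (by rw [conj_re]; linarith)
  rw [LFunction_inv_conj_of_one_lt_re _ hs, gammaFactor_inv_conj, ← map_mul, ← h] at h'
  rw [DirichletCharacter.completedLFunction_modOne_eq, DirichletCharacter.completedLFunction_modOne_eq,
    completedRiemannZeta_eq, completedRiemannZeta_eq] at h'
  simp only [map_sub, map_div₀, map_one] at h'
  linear_combination h'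

/-- Growth of the completed `L`-function to the right of the critical strip. -/
lemma exists_norm_completedLFunction_le {N : ℕ} [NeZero N] (χ : DirichletCharacter ℂ N) :
    ∃ C, 0 ≤ C ∧ ∀ s : ℂ, 4 ≤ s.re →
      ‖χ.completedLFunction s‖ ≤ Real.exp (C * (1 + ‖s‖) ^ (3 / 2 : ℝ)) := by
  obtain ⟨C, hC⟩ := exists_norm_LFunction_le χ
  refine ⟨|C| + 2 * 2 ^ (3 / 2 : ℝ), by positivity, fun s hs ↦ ?_⟩
  have h1 : 1 ≤ (1 + ‖s‖) ^ (3 / 2 : ℝ) :=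
    Real.one_le_rpow (by linarith [norm_nonneg s]) (by norm_num)
  have h2 : ‖χ.LFunction s‖ ≤ Real.exp (|C| * (1 + ‖s‖) ^ (3 / 2 : ℝ)) := by
    refine (hC s hs).trans ((le_abs_self C).trans ?_)
    have h3 := Real.add_one_le_exp (|C| * (1 + ‖s‖) ^ (3 / 2 : ℝ))
    have h4 := le_mul_of_one_le_right (abs_nonneg C) h1
    linarith
  have h3 : ‖χ.gammaFactor s‖ ≤ Real.exp (2 * 2 ^ (3 / 2 : ℝ) * (1 + ‖s‖) ^ (3 / 2 : ℝ)) := by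
    have key : ∀ z : ℂ, 4 ≤ z.re → ‖z‖ ≤ 1 + ‖s‖ →
        ‖Gammaℝ z‖ ≤ Real.exp (2 * 2 ^ (3 / 2 : ℝ) * (1 + ‖s‖) ^ (3 / 2 : ℝ)) := by
      intro z hz hzs
      refine (norm_Gammaℝ_le hz).trans (Real.exp_le_exp.mpr ?_)
      rw [mul_assoc, ← Real.mul_rpow (by norm_num) (by positivity)]
      gcongr
      linarith [norm_nonneg s]
    rw [DirichletCharacter.gammaFactor]
    split_ifs
    · exact key s hs (by linarith)
    · refine key _ (by rw [add_re, one_re]; linarith) ?_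
      rw [add_comm 1]
      exact (norm_add_le _ _).trans (by simp)
  rw [completedLFunction_eq_mul χ (by linarith), norm_mul, add_mul, Real.exp_add]
  gcongr

/-- A function with a symmetric absolute value that is of order at most `3/2` in the far right
half-plane and of polynomial growth on a strip is of order at most `3/2`. -/
lemma exists_norm_le_exp {f : ℂ → ℂ} (hsymm : ∀ w, ‖f (-conj w)‖ = ‖f w‖) {C D : ℝ}
    (hC : ∀ w : ℂ, 4 ≤ w.re → ‖f w‖ ≤ Real.exp (C * (1 + ‖w‖) ^ (3 / 2 : ℝ)))
    (hD : ∀ w : ℂ, 0 ≤ w.re → w.re ≤ 4 → ‖f w‖ ≤ D * (1 + ‖w‖) ^ 2) :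
    ∃ K, ∀ w, ‖f w‖ ≤ Real.exp (K * (1 + ‖w‖) ^ (3 / 2 : ℝ)) := by
  refine ⟨|C| + |D| + 2, ?_⟩
  suffices H : ∀ w : ℂ, 0 ≤ w.re → ‖f w‖ ≤ Real.exp ((|C| + |D| + 2) * (1 + ‖w‖) ^ (3 / 2 : ℝ)) by
    intro w
    rcases le_total 0 w.re with h | h
    · exact H w h
    · have := H (-conj w) (by simpa using h)
      rwa [hsymm, norm_neg, norm_conj] at this
  intro w hw
  set X := (1 + ‖w‖) ^ (3 / 2 : ℝ) with hX
  have h1 : 1 + ‖w‖ ≤ X := by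
    conv_lhs => rw [← Real.rpow_one (1 + ‖w‖)]
    exact Real.rpow_le_rpow_of_exponent_le (by linarith [norm_nonneg w]) (by norm_num)
  have h0 : 1 ≤ X := by linarith [norm_nonneg w]
  rcases le_total 4 w.re with h | h
  · refine (hC w h).trans (Real.exp_le_exp.mpr ?_)
    have := le_abs_self C
    gcongr
    linarith [abs_nonneg D]
  · refine (hD w hw h).trans ?_
    have e1 : D ≤ Real.exp (|D| * X) := by
      have := Real.add_one_le_exp (|D| * X)
      have := le_mul_of_one_le_right (abs_nonneg D) h0
      linarith [le_abs_self D]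
    have e2 : (1 + ‖w‖) ^ 2 ≤ Real.exp (2 * X) := by
      rw [mul_comm, Real.exp_mul]
      norm_cast
      gcongr
      linarith [Real.add_one_le_exp X]
    calc D * (1 + ‖w‖) ^ 2 ≤ Real.exp (|D| * X) * Real.exp (2 * X) := by gcongr
      _ = Real.exp ((|D| + 2) * X) := by rw [← Real.exp_add]; ring_nf
      _ ≤ _ := by
        gcongr
        linarith [abs_nonneg C]

end Conjugation

/-! ### Zeros of individual L-functions -/

section CompletedLFunctions

open Complex Metric Filter Topology ComplexConjugate

/-- Transfer of a sum over zeros of an auxiliary function to the zeros of an `L`-function on the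
critical line. -/
lemma hasSum_zeroTerm_of_eq_mul {q : ℕ} [NeZero q] (χ : DirichletCharacter ℂ q) {f v : ℂ → ℂ} {B : ℝ}
    (hf : Differentiable ℂ f) (hv : ∀ w : ℂ, w.re = 0 → AnalyticAt ℂ v w)
    (hv0 : ∀ w : ℂ, w.re = 0 → v w ≠ 0)
    (hfv : ∀ w : ℂ, |w.re| < 1 / 2 → χ.LFunction (1 / 2 + w) = f w * v w)
    (hsum : HasSum (fun γ : {γ : ℝ | f (γ * I) = 0} ↦
      (analyticOrderNatAt f ((γ : ℝ) * I) : ℝ) * (1 / (1 / 4 + (γ : ℝ) ^ 2))) B) :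
    HasSum (fun γ : ordinates χ ↦ zeroTerm χ γ) B := by
  have hre : ∀ γ : ℝ, ((γ : ℂ) * I).re = 0 := fun γ ↦ by simp
  have hL : ∀ γ : ℝ, χ.LFunction (critPt γ) = f (γ * I) * v (γ * I) := fun γ ↦
    hfv _ (by rw [hre]; norm_num)
  have hset : ordinates χ = {γ : ℝ | f (γ * I) = 0} := by
    ext γ
    simp [ordinates, hL γ, hv0 _ (hre γ)]
  have hterm : ∀ γ : ℝ, zeroTerm χ γ =
      (analyticOrderNatAt f ((γ : ℝ) * I) : ℝ) * (1 / (1 / 4 + (γ : ℝ) ^ 2)) := by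
    intro γ
    have hne : critPt γ ≠ 1 := fun h ↦ by
      have := congrArg re h
      norm_num [critPt] at this
    have hLan : AnalyticAt ℂ χ.LFunction (critPt γ) := by
      refine DifferentiableOn.analyticAt (s := {1}ᶜ) (fun z hz ↦ ?_) (isOpen_compl_singleton.mem_nhds hne)
      exact (DirichletCharacter.differentiableAt_LFunction χ z (.inl hz)).differentiableWithinAt
    have h1 : analyticOrderAt χ.LFunction (critPt γ) =
        analyticOrderAt (χ.LFunction ∘ fun w ↦ 1 / 2 + w) (γ * I) := by
      rw [analyticOrderAt_comp_of_deriv_ne_zero (by fun_prop) (by simp)]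
      rfl
    have h2 : (χ.LFunction ∘ fun w ↦ 1 / 2 + w) =ᶠ[𝓝 ((γ : ℂ) * I)] f * v := by
      have : {w : ℂ | |w.re| < 1 / 2} ∈ 𝓝 ((γ : ℂ) * I) :=
        (isOpen_lt (by fun_prop) continuous_const).mem_nhds (by simp)
      filter_upwards [this] with w hw using hfv w hw
    have h3 : analyticOrderAt χ.LFunction (critPt γ) = analyticOrderAt f (γ * I) := by
      rw [h1, analyticOrderAt_congr h2, analyticOrderAt_mul (hf.analyticAt _) (hv _ (hre γ)),
        (hv _ (hre γ)).analyticOrderAt_eq_zero.mpr (hv0 _ (hre γ)), add_zero]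
    rw [zeroTerm, analyticOrderNatAt, analyticOrderNatAt, h3]
  simp_rw [hterm]
  rw [hset]
  exact hsum

/-- The product of Euler factors relating an imprimitive `L`-function to the primitive one. -/
noncomputable def eulerFactors {d : ℕ} (ψ : DirichletCharacter ℂ d) (q : ℕ) (s : ℂ) : ℂ :=
  ∏ p ∈ q.primeFactors, (1 - ψ p * (p : ℂ) ^ (-s))

lemma differentiable_eulerFactors {d : ℕ} (ψ : DirichletCharacter ℂ d) (q : ℕ) :
    Differentiable ℂ (eulerFactors ψ q) := by
  refine Differentiable.fun_finsetProd fun p hp ↦ ?_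
  have : NeZero p := ⟨(Nat.prime_of_mem_primeFactors hp).ne_zero⟩
  fun_prop

/-- Each `ψ(p) p ^ (-s)` has modulus below `1`. Hence passing to the primitive character changes no
zero, and no multiplicity, in the open critical strip. -/
lemma eulerFactors_ne_zero {d : ℕ} (ψ : DirichletCharacter ℂ d) (q : ℕ) {s : ℂ} (hs : 0 < s.re) :
    eulerFactors ψ q s ≠ 0 := by
  refine Finset.prod_ne_zero_iff.mpr fun p hp h ↦ ?_
  have hp' := Nat.prime_of_mem_primeFactors hp
  have h1 : ‖ψ p * (p : ℂ) ^ (-s)‖ < 1 := by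
    rw [norm_mul, norm_natCast_cpow_of_pos hp'.pos, neg_re]
    have h2 : (p : ℝ) ^ (-s.re) < 1 :=
      Real.rpow_lt_one_of_one_lt_of_neg (by exact_mod_cast hp'.one_lt) (by linarith)
    have h3 := ψ.norm_le_one p
    have h4 : 0 ≤ (p : ℝ) ^ (-s.re) := by positivity
    nlinarith
  rw [← sub_eq_zero.mp h, norm_one] at h1
  exact lt_irrefl _ h1

lemma LFunction_eq_mul_eulerFactors {q : ℕ} [NeZero q] (χ : DirichletCharacter ℂ q) {s : ℂ}
    (hs : s ≠ 1) :
    χ.LFunction s = χ.primitiveCharacter.LFunction s * eulerFactors χ.primitiveCharacter q s := by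
  have := DirichletCharacter.LFunction_changeLevel χ.conductor_dvd_level χ.primitiveCharacter
    (s := s) (.inr hs)
  rwa [χ.changeLevel_primitiveCharacter] at this

/-- The even factor is `Gammaℝ` at `1`, with `Γ'/Γ(1/2) = -γ₀ - 2 log 2`; the odd one is `Gammaℝ` at
`2`, with `Γ'/Γ(1) = -γ₀`. The coefficient `(1 + ψ(-1))/2` selects the extra `log 2`. -/
lemma re_logDeriv_gammaFactor_one {N : ℕ} (ψ : DirichletCharacter ℂ N) :
    (logDeriv ψ.gammaFactor 1).re = -(Real.eulerMascheroniConstant + Real.log Real.pi) / 2 -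
      (1 + (ψ (-1)).re) / 2 * Real.log 2 := by
  rcases ψ.even_or_odd with h | h
  · rw [show ψ.gammaFactor = Gammaℝ from funext h.gammaFactor_def, logDeriv_apply,
      hasDerivAt_Gammaℝ_one.deriv, Gammaℝ_one, div_one, show ψ (-1) = 1 from h]
    have : (-((Real.eulerMascheroniConstant : ℂ) + log (4 * Real.pi)) / 2) =
        ((-(Real.eulerMascheroniConstant + Real.log (4 * Real.pi)) / 2 : ℝ) : ℂ) := by
      push_cast [ofReal_log (show (0 : ℝ) ≤ 4 * Real.pi by positivity)]
      ring
    rw [this, ofReal_re, Real.log_mul (by norm_num) Real.pi_ne_zero,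
      show (4 : ℝ) = 2 ^ 2 by norm_num, Real.log_pow, one_re]
    push_cast
    ring
  · have hG : HasDerivAt (fun s : ℂ ↦ Gamma ((s + 1) / 2)) (-Real.eulerMascheroniConstant / 2) 1 := by
      have h1 : HasDerivAt (fun s : ℂ ↦ (s + 1) / 2) (1 / 2) 1 :=
        ((hasDerivAt_id (1 : ℂ)).add_const 1).div_const 2
      have h2 : HasDerivAt Gamma (-Real.eulerMascheroniConstant) (((1 : ℂ) + 1) / 2) := by
        convert hasDerivAt_Gamma_one using 1
        norm_num
      exact (h2.comp 1 h1).congr_deriv (by ring)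
    have hP : HasDerivAt (fun s : ℂ ↦ (Real.pi : ℂ) ^ (-(s + 1) / 2))
        ((Real.pi : ℂ) ^ (-1 : ℂ) * log Real.pi * (-1 / 2)) 1 := by
      have h1 : HasDerivAt (fun s : ℂ ↦ -(s + 1) / 2) (-1 / 2) 1 :=
        (((hasDerivAt_id (1 : ℂ)).add_const 1).neg).div_const 2
      have := h1.const_cpow (c := Real.pi) (.inl (by exact_mod_cast Real.pi_ne_zero))
      refine this.congr_deriv ?_
      norm_num
    have hpi : (Real.pi : ℂ) ≠ 0 := by exact_mod_cast Real.pi_ne_zero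
    rw [show ψ.gammaFactor = fun s ↦ (Real.pi : ℂ) ^ (-(s + 1) / 2) * Gamma ((s + 1) / 2) from
      funext fun s ↦ (h.gammaFactor_def s).trans (Gammaℝ_def _), logDeriv_apply,
      (hP.fun_mul hG).deriv, show ψ (-1) = -1 from h, show ((1 : ℂ) + 1) / 2 = 1 by norm_num, Gamma_one,
      show -((1 : ℂ) + 1) / 2 = -1 by norm_num, cpow_neg_one]
    have : ((Real.pi : ℂ)⁻¹ * log Real.pi * (-1 / 2) * 1 +
        (Real.pi : ℂ)⁻¹ * (-Real.eulerMascheroniConstant / 2)) / ((Real.pi : ℂ)⁻¹ * 1) =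
        ((-(Real.eulerMascheroniConstant + Real.log Real.pi) / 2 : ℝ) : ℂ) := by
      push_cast [ofReal_log Real.pi_pos.le]
      field_simp
      ring
    rw [this, ofReal_re, neg_re, one_re]
    ring

lemma differentiableAt_gammaFactor {N : ℕ} (ψ : DirichletCharacter ℂ N) {s : ℂ}
    (hs : 0 < s.re) :
    DifferentiableAt ℂ ψ.gammaFactor s := by
  have key : ∀ z : ℂ, 0 < z.re → DifferentiableAt ℂ Gammaℝ z := fun z hz ↦ by
    have := (differentiable_Gammaℝ_inv z).fun_inv (inv_ne_zero (Gammaℝ_ne_zero_of_re_pos hz))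
    simpa only [inv_inv] using this
  rcases ψ.even_or_odd with h | h
  · rw [show ψ.gammaFactor = Gammaℝ from funext h.gammaFactor_def]
    exact key s hs
  · rw [show ψ.gammaFactor = fun s ↦ Gammaℝ (s + 1) from funext h.gammaFactor_def]
    exact DifferentiableAt.comp (g := Gammaℝ) (f := fun s ↦ s + 1) s
      (key (s + 1) (by rw [add_re, one_re]; linarith)) (by fun_prop)

section Nontrivial

variable {N : ℕ} [NeZero N] {ψ : DirichletCharacter ℂ N}

/-- The completed `L`-function, normalized to have symmetric absolute value and centred at the
point `1/2`. -/
noncomputable def xi (ψ : DirichletCharacter ℂ N) (w : ℂ) : ℂ :=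
  (N : ℂ) ^ (w / 2) * ψ.completedLFunction (1 / 2 + w)

lemma differentiable_xi (hψ : ψ ≠ 1) : Differentiable ℂ (xi ψ) := by
  have := DirichletCharacter.differentiable_completedLFunction hψ
  have : Differentiable ℂ fun w ↦ ψ.completedLFunction (1 / 2 + w) := this.comp (by fun_prop)
  unfold xi
  fun_prop

lemma xi_ne_zero_of_half_le_re (hψ : ψ ≠ 1) {w : ℂ} (hw : 1 / 2 ≤ w.re) : xi ψ w ≠ 0 := by
  have hre : (1 / 2 + w).re = 1 / 2 + w.re := by simp
  refine mul_ne_zero (by simp [cpow_eq_zero_iff, NeZero.ne N]) ?_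
  rw [completedLFunction_eq_mul _ (by rw [hre]; linarith)]
  exact mul_ne_zero (DirichletCharacter.LFunction_ne_zero_of_one_le_re ψ (.inl hψ)
    (by rw [hre]; linarith)) (gammaFactor_ne_zero _ (by rw [hre]; linarith))

/-- The functional equation exchanges `ψ` and `ψ⁻¹`, and conjugation exchanges them back, leaving
the factor `‖ψ.rootNumber‖`. -/
lemma norm_xi_neg_conj (hψ : ψ ≠ 1) (hprim : ψ.IsPrimitive) (w : ℂ) :
    ‖xi ψ (-conj w)‖ = ‖xi ψ w‖ := by
  have hN : (0 : ℝ) < N := by exact_mod_cast NeZero.pos N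
  have key : ∀ w, ‖xi ψ (-conj w)‖ = ‖ψ.rootNumber‖ * ‖xi ψ w‖ := by
    intro w
    have h1 : ψ.completedLFunction (1 / 2 + -conj w) =
        (N : ℂ) ^ (conj w) * ψ.rootNumber * conj (ψ.completedLFunction (1 / 2 + w)) := by
      rw [← completedLFunction_inv_conj hψ, show (1 / 2 + -conj w) = 1 - conj (1 / 2 + w) by
        simp only [map_add, map_div₀, map_one, conj_ofNat]; ring, hprim.completedLFunction_one_sub]
      congr 3
      simp only [map_add, map_div₀, map_one, conj_ofNat]; ring
    have e1 : (-conj w / 2).re = -w.re / 2 := by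
      rw [div_ofNat_re, neg_re, conj_re]
    rw [xi, xi, h1, norm_mul, norm_mul, norm_mul, norm_mul, norm_conj,
      norm_natCast_cpow_of_pos (NeZero.pos N), norm_natCast_cpow_of_pos (NeZero.pos N),
      norm_natCast_cpow_of_pos (NeZero.pos N), e1, conj_re, div_ofNat_re]
    have : (N : ℝ) ^ (-w.re / 2) * (N : ℝ) ^ w.re = (N : ℝ) ^ (w.re / 2) := by
      rw [← Real.rpow_add hN]; ring_nf
    rw [← this]; ring
  -- The points `1/2` and `-1/2` are reflections of each other and `xi ψ (1/2) ≠ 0`, so two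
  -- applications give `‖ψ.rootNumber‖ ^ 2 = 1` without evaluating a Gauss sum.
  have h1 := key (1 / 2)
  have h2 := key (-(1 / 2))
  have e : conj (1 / 2 : ℂ) = 1 / 2 := by simp only [map_div₀, map_one, conj_ofNat]
  rw [map_neg, e, neg_neg] at h2
  rw [e] at h1
  have hpos : 0 < ‖xi ψ (1 / 2)‖ := norm_pos_iff.mpr (xi_ne_zero_of_half_le_re hψ (by norm_num))
  have h3 : ‖ψ.rootNumber‖ = 1 := by
    rw [h1, ← mul_assoc] at h2
    have h4 : ‖ψ.rootNumber‖ * ‖ψ.rootNumber‖ = 1 := by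
      nlinarith
    nlinarith [norm_nonneg ψ.rootNumber]
  rw [key, h3, one_mul]

/-- Nonvanishing on `Re s ≥ 1`, reflected by the symmetry, excludes zeros outside the open strip;
inside it the gamma factor is nonzero and GRH applies. -/
lemma re_eq_zero_of_xi_eq_zero (hGRH : GRH) (hψ : ψ ≠ 1) (hprim : ψ.IsPrimitive) {w : ℂ}
    (hw : xi ψ w = 0) : w.re = 0 := by
  by_cases h1 : 1 / 2 ≤ w.re
  · exact absurd hw (xi_ne_zero_of_half_le_re hψ h1)
  by_cases h2 : w.re ≤ -1 / 2
  · refine absurd ?_ (xi_ne_zero_of_half_le_re (w := -conj w) hψ (by rw [neg_re, conj_re]; linarith))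
    rw [← norm_eq_zero, norm_xi_neg_conj hψ hprim, hw, norm_zero]
  push Not at h1 h2
  have hre : (1 / 2 + w).re = 1 / 2 + w.re := by simp
  have hpos : 0 < (1 / 2 + w).re := by rw [hre]; linarith
  rcases mul_eq_zero.mp hw with h | h
  · simp [cpow_eq_zero_iff, NeZero.ne N] at h
  · rw [completedLFunction_eq_mul _ hpos] at h
    have := hGRH N ψ _ ((mul_eq_zero.mp h).resolve_right (gammaFactor_ne_zero _ hpos)) hpos
      (by rw [hre]; linarith)
    rw [hre] at this
    linarith

lemma exists_norm_xi_le (hψ : ψ ≠ 1) (hprim : ψ.IsPrimitive) :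
    ∃ K, ∀ w, ‖xi ψ w‖ ≤ Real.exp (K * (1 + ‖w‖) ^ (3 / 2 : ℝ)) := by
  have hN : (1 : ℝ) ≤ N := by exact_mod_cast NeZero.one_le
  obtain ⟨C, hC0, hC⟩ := exists_norm_completedLFunction_le ψ
  obtain ⟨D, hD⟩ := exists_norm_completedLFunction₀_le (ψ : ZMod N → ℂ) (a := 1 / 2) (b := 9 / 2)
    (by norm_num)
  -- The polar terms carry the factors `ψ 0` and `∑ ψ j`, both zero.
  have hcomp : ∀ s, ψ.completedLFunction s = ZMod.completedLFunction₀ ψ s := by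
    intro s
    have hN1 : N ≠ 1 := fun h ↦ hψ (DirichletCharacter.level_one' ψ h)
    rw [DirichletCharacter.completedLFunction, ZMod.completedLFunction_eq, ψ.map_zero' hN1,
      ψ.sum_eq_zero_of_ne_one hψ]
    simp
  have hcpow : ∀ w : ℂ, ‖(N : ℂ) ^ (w / 2)‖ = (N : ℝ) ^ (w.re / 2) := fun w ↦ by
    rw [norm_natCast_cpow_of_pos (NeZero.pos N), div_ofNat_re]
  have hre : ∀ w : ℂ, (1 / 2 + w).re = 1 / 2 + w.re := fun w ↦ by simp
  refine exists_norm_le_exp (norm_xi_neg_conj hψ hprim) (C := Real.log N + C * 2 ^ (3 / 2 : ℝ))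
    (D := (N : ℝ) ^ (2 : ℝ) * |D|) (fun w hw ↦ ?_) (fun w h0 h4 ↦ ?_)
  · rw [xi, norm_mul, add_mul, Real.exp_add, hcpow]
    have h1 : 1 + ‖w‖ ≤ (1 + ‖w‖) ^ (3 / 2 : ℝ) := by
      conv_lhs => rw [← Real.rpow_one (1 + ‖w‖)]
      exact Real.rpow_le_rpow_of_exponent_le (by linarith [norm_nonneg w]) (by norm_num)
    gcongr
    · rw [Real.rpow_def_of_pos (by linarith)]
      have h2 := re_le_norm w
      have h3 := Real.log_nonneg hN
      gcongr
      linarith [norm_nonneg w]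
    · refine (hC _ (by rw [hre]; linarith)).trans (Real.exp_le_exp.mpr ?_)
      rw [mul_assoc, ← Real.mul_rpow (by norm_num) (by positivity)]
      gcongr
      have : ‖1 / 2 + w‖ ≤ 1 / 2 + ‖w‖ := (norm_add_le _ _).trans (by norm_num)
      linarith [norm_nonneg w]
  · rw [xi, norm_mul, hcpow, hcomp, mul_assoc]
    have h1 : ‖ZMod.completedLFunction₀ ψ (1 / 2 + w)‖ ≤ |D| :=
      (hD _ (by rw [hre]; linarith) (by rw [hre]; linarith)).trans (le_abs_self D)
    have h2 : 1 ≤ (1 + ‖w‖) ^ 2 := one_le_pow₀ (by linarith [norm_nonneg w])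
    gcongr
    · linarith
    · exact h1.trans (le_mul_of_one_le_right (abs_nonneg D) h2)

lemma two_mul_re_logDeriv_xi_half (hψ : ψ ≠ 1) :
    2 * (logDeriv (xi ψ) (1 / 2)).re = Real.log N -
      (Real.eulerMascheroniConstant + Real.log Real.pi) - (1 + (ψ (-1)).re) * Real.log 2 +
      2 * (deriv ψ.LFunction 1 / ψ.LFunction 1).re := by
  have hN : (N : ℂ) ≠ 0 := by exact_mod_cast NeZero.ne N
  have heq : xi ψ =ᶠ[𝓝 (1 / 2)] fun w ↦ (N : ℂ) ^ (w / 2) *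
      (ψ.LFunction (1 / 2 + w) * ψ.gammaFactor (1 / 2 + w)) := by
    filter_upwards [(isOpen_lt continuous_const continuous_re).mem_nhds
      (show (0 : ℝ) < (1 / 2 : ℂ).re by norm_num)] with w hw
    have hw' : 0 < w.re := hw
    rw [xi, completedLFunction_eq_mul]
    rw [add_re]
    norm_num
    linarith
  have hone : (1 / 2 + 1 / 2 : ℂ) = 1 := by norm_num
  have hshift : ∀ w : ℂ, HasDerivAt (fun w : ℂ ↦ 1 / 2 + w) 1 w := fun w ↦
    (hasDerivAt_id w).const_add _
  have h1 : HasDerivAt (fun w : ℂ ↦ (N : ℂ) ^ (w / 2)) ((N : ℂ) ^ ((1 / 2 : ℂ) / 2) * log N * (1 / 2))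
      (1 / 2) := ((hasDerivAt_id (1 / 2 : ℂ)).div_const 2).const_cpow (.inl hN)
  have h2 : HasDerivAt (fun w ↦ ψ.LFunction (1 / 2 + w)) (deriv ψ.LFunction 1) (1 / 2) := by
    have := (DirichletCharacter.differentiable_LFunction hψ (1 / 2 + 1 / 2)).hasDerivAt.comp
      (1 / 2 : ℂ) (hshift _)
    rw [mul_one, hone] at this
    exact this
  have h3 : HasDerivAt (fun w ↦ ψ.gammaFactor (1 / 2 + w)) (deriv ψ.gammaFactor 1) (1 / 2) := by
    have := (differentiableAt_gammaFactor ψ (s := 1 / 2 + 1 / 2) (by norm_num)).hasDerivAt.comp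
      (1 / 2 : ℂ) (hshift _)
    rw [mul_one, hone] at this
    exact this
  have hL := DirichletCharacter.LFunction_apply_one_ne_zero hψ
  have hg := gammaFactor_ne_zero ψ (s := 1) (by norm_num)
  have hp : (N : ℂ) ^ ((1 / 2 : ℂ) / 2) ≠ 0 := by simp [cpow_eq_zero_iff, hN]
  have hlog : logDeriv (xi ψ) (1 / 2) = (Real.log N / 2 : ℝ) +
      (deriv ψ.LFunction 1 / ψ.LFunction 1 + logDeriv ψ.gammaFactor 1) := by
    rw [(logDeriv_congr_nhds heq).eq_of_nhds, logDeriv_apply, (h1.fun_mul (h2.fun_mul h3)).deriv,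
      logDeriv_apply]
    simp only [hone]
    push_cast
    rw [← natCast_log]
    generalize (N : ℂ) ^ ((1 / 2 : ℂ) / 2) = c at *
    field_simp
  rw [hlog, add_re, add_re, ofReal_re, re_logDeriv_gammaFactor_one]
  ring

end Nontrivial

lemma primitiveCharacter_ne_one {q : ℕ} [NeZero q] {χ : DirichletCharacter ℂ q} (hχ : χ ≠ 1) :
    χ.primitiveCharacter ≠ 1 := fun h ↦ hχ <| by
  rw [← χ.changeLevel_primitiveCharacter, h, map_one]

lemma primitiveCharacter_neg_one {q : ℕ} [NeZero q] (χ : DirichletCharacter ℂ q) :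
    χ.primitiveCharacter (-1) = χ (-1) := by
  have := χ.primitiveCharacter_apply_of_isCoprime (a := -1) isCoprime_one_left.neg_left
  simpa using this

/-- The sum over zeros attached to a nonprincipal character. -/
theorem hasSum_zeroTerm_of_ne_one (hGRH : GRH) {q : ℕ} [NeZero q] {χ : DirichletCharacter ℂ q}
    (hχ : χ ≠ 1) :
    HasSum (fun γ : ordinates χ ↦ zeroTerm χ γ) (Real.log χ.conductor -
      (Real.eulerMascheroniConstant + Real.log Real.pi) - (1 + (χ (-1)).re) * Real.log 2 +
      2 * (deriv χ.primitiveCharacter.LFunction 1 / χ.primitiveCharacter.LFunction 1).re) := by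
  set ψ := χ.primitiveCharacter with hψdef
  have hψ : ψ ≠ 1 := primitiveCharacter_ne_one hχ
  have hprim : ψ.IsPrimitive := χ.primitiveCharacter_isPrimitive
  have hN : (χ.conductor : ℂ) ≠ 0 := by exact_mod_cast NeZero.ne χ.conductor
  obtain ⟨K, hK⟩ := exists_norm_xi_le hψ hprim
  have hsum := hasSum_zeros (differentiable_xi hψ)
    (fun w hw ↦ re_eq_zero_of_xi_eq_zero hGRH hψ hprim hw) (norm_xi_neg_conj hψ hprim) hK
  rw [two_mul_re_logDeriv_xi_half hψ, hψdef, primitiveCharacter_neg_one] at hsum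
  -- `v` undoes the conductor and gamma factors and restores the missing Euler factors; it has no
  -- zero on the critical line.
  refine hasSum_zeroTerm_of_eq_mul χ (v := fun w ↦ (χ.conductor : ℂ) ^ (-w / 2) *
    (ψ.gammaFactor (1 / 2 + w))⁻¹ * eulerFactors ψ q (1 / 2 + w))
    (differentiable_xi hψ) (fun w hw ↦ ?_) (fun w hw ↦ ?_) (fun w hw ↦ ?_) hsum
  · have hpos : 0 < (1 / 2 + w).re := by rw [add_re, hw]; norm_num
    have hopen : {z : ℂ | 0 < (1 / 2 + z).re} ∈ 𝓝 w :=
      (isOpen_lt continuous_const (by fun_prop)).mem_nhds hpos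
    refine DifferentiableOn.analyticAt (s := {z : ℂ | 0 < (1 / 2 + z).re}) (fun z hz ↦ ?_) hopen
    refine DifferentiableAt.differentiableWithinAt ?_
    have hz' : 0 < (1 / 2 + z).re := hz
    have hg : DifferentiableAt ℂ (fun w ↦ ψ.gammaFactor (1 / 2 + w)) z :=
      (differentiableAt_gammaFactor ψ hz').comp z (by fun_prop)
    have he : DifferentiableAt ℂ (fun w ↦ eulerFactors ψ q (1 / 2 + w)) z :=
      ((differentiable_eulerFactors ψ q) _).comp z (by fun_prop)
    exact (DifferentiableAt.mul (by fun_prop) (hg.inv (gammaFactor_ne_zero ψ hz'))).mul he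
  · have hpos : 0 < (1 / 2 + w).re := by rw [add_re, hw]; norm_num
    exact mul_ne_zero (mul_ne_zero (by simp [cpow_eq_zero_iff, hN])
      (inv_ne_zero (gammaFactor_ne_zero ψ hpos))) (eulerFactors_ne_zero ψ q hpos)
  · have hpos : 0 < (1 / 2 + w).re := by
      rw [add_re]; norm_num; linarith [(abs_lt.mp hw).1]
    have hne : 1 / 2 + w ≠ 1 := fun h ↦ by
      have := congrArg re h
      rw [add_re] at this
      norm_num at this
      linarith [(abs_lt.mp hw).2]
    rw [LFunction_eq_mul_eulerFactors χ hne, ← hψdef, xi, completedLFunction_eq_mul _ hpos, neg_div, cpow_neg]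
    have := gammaFactor_ne_zero ψ hpos
    have : (χ.conductor : ℂ) ^ (w / 2) ≠ 0 := by simp [cpow_eq_zero_iff, hN]
    generalize 1 / 2 + w = s at *
    field_simp

/-- The completed Riemann zeta function without its poles, centred at the point `1/2`. -/
noncomputable def xiZeta (w : ℂ) : ℂ :=
  (1 / 2 + w) * (1 / 2 - w) * completedRiemannZeta₀ (1 / 2 + w) - 1

lemma differentiable_xiZeta : Differentiable ℂ xiZeta := by
  have : Differentiable ℂ fun w ↦ completedRiemannZeta₀ (1 / 2 + w) :=
    differentiable_completedZeta₀.comp (by fun_prop)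
  unfold xiZeta
  fun_prop

/-- With `s = 1/2 + w`, the `-1` absorbs both poles, since `1/s + 1/(1 - s) = 1/(s(1 - s))`. -/
lemma xiZeta_eq {w : ℂ} (h0 : 1 / 2 + w ≠ 0) (h1 : 1 / 2 - w ≠ 0) :
    xiZeta w = (1 / 2 + w) * (1 / 2 - w) * completedRiemannZeta (1 / 2 + w) := by
  rw [completedRiemannZeta_eq, xiZeta, show (1 : ℂ) - (1 / 2 + w) = 1 / 2 - w by ring]
  have h : (1 / 2 + w) + (1 / 2 - w) = 1 := by ring
  generalize 1 / 2 + w = s at *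
  generalize 1 / 2 - w = t at *
  field_simp
  linear_combination h

lemma xiZeta_eq_riemannZeta_mul {w : ℂ} (h0 : 0 < (1 / 2 + w).re) (h1 : 1 / 2 - w ≠ 0) :
    xiZeta w = (1 / 2 + w) * (1 / 2 - w) * (riemannZeta (1 / 2 + w) * Gammaℝ (1 / 2 + w)) := by
  have h0' : 1 / 2 + w ≠ 0 := fun h ↦ by rw [h] at h0; simp at h0
  rw [xiZeta_eq h0' h1, riemannZeta_def_of_ne_zero h0',
    div_mul_cancel₀ _ (Gammaℝ_ne_zero_of_re_pos h0)]

lemma norm_xiZeta_neg_conj (w : ℂ) : ‖xiZeta (-conj w)‖ = ‖xiZeta w‖ := by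
  have h : xiZeta (-conj w) = conj (xiZeta w) := by
    have e : (1 / 2 + -conj w : ℂ) = 1 - conj (1 / 2 + w) := by
      simp only [map_add, map_div₀, map_one, conj_ofNat]; ring
    rw [xiZeta, xiZeta, e, completedRiemannZeta₀_one_sub, completedRiemannZeta₀_conj]
    simp only [map_add, map_sub, map_mul, map_div₀, map_one, conj_ofNat]
    ring
  rw [h, norm_conj]

lemma xiZeta_ne_zero_of_half_le_re {w : ℂ} (hw : 1 / 2 ≤ w.re) : xiZeta w ≠ 0 := by
  by_cases h : 1 / 2 - w = 0
  -- At the pole `s = 1` the product vanishes and the value is `-1`.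
  · rw [xiZeta, h]
    simp
  have hre : (1 / 2 + w).re = 1 / 2 + w.re := by simp
  have hpos : 0 < (1 / 2 + w).re := by rw [hre]; linarith
  rw [xiZeta_eq_riemannZeta_mul hpos h]
  refine mul_ne_zero (mul_ne_zero (fun h ↦ by rw [h] at hpos; simp at hpos) h)
    (mul_ne_zero (riemannZeta_ne_zero_of_one_le_re (by rw [hre]; linarith))
      (Gammaℝ_ne_zero_of_re_pos hpos))

lemma re_eq_zero_of_xiZeta_eq_zero (hGRH : GRH) {w : ℂ} (hw : xiZeta w = 0) : w.re = 0 := by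
  by_cases h1 : 1 / 2 ≤ w.re
  · exact absurd hw (xiZeta_ne_zero_of_half_le_re h1)
  by_cases h2 : w.re ≤ -1 / 2
  · refine absurd ?_ (xiZeta_ne_zero_of_half_le_re (w := -conj w) (by rw [neg_re, conj_re]; linarith))
    rw [← norm_eq_zero, norm_xiZeta_neg_conj, hw, norm_zero]
  push Not at h1 h2
  have hre : (1 / 2 + w).re = 1 / 2 + w.re := by simp
  have hpos : 0 < (1 / 2 + w).re := by rw [hre]; linarith
  have h3 : 1 / 2 - w ≠ 0 := fun h ↦ by
    have := congrArg re h
    norm_num at this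
    linarith
  rw [xiZeta_eq_riemannZeta_mul hpos h3] at hw
  have h4 : 1 / 2 + w ≠ 0 := fun h ↦ by rw [h] at hpos; simp at hpos
  have h5 := (mul_eq_zero.mp ((mul_eq_zero.mp hw).resolve_left (mul_ne_zero h4 h3))).resolve_right
    (Gammaℝ_ne_zero_of_re_pos hpos)
  have := hGRH 1 1 (1 / 2 + w) (by rw [DirichletCharacter.LFunction_modOne_eq, h5]) hpos
    (by rw [hre]; linarith)
  rw [hre] at this
  linarith

lemma exists_norm_xiZeta_le :
    ∃ K, ∀ w, ‖xiZeta w‖ ≤ Real.exp (K * (1 + ‖w‖) ^ (3 / 2 : ℝ)) := by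
  obtain ⟨C, hC0, hC⟩ := exists_norm_completedLFunction_le (1 : DirichletCharacter ℂ 1)
  obtain ⟨D, hD⟩ := exists_norm_Λ₀_le (HurwitzZeta.hurwitzEvenFEPair 0) (1 / 4) (9 / 4)
  have hre : ∀ w : ℂ, (1 / 2 + w).re = 1 / 2 + w.re := fun w ↦ by simp
  have hpoly : ∀ w : ℂ, ‖(1 / 2 + w) * (1 / 2 - w)‖ ≤ (1 + ‖w‖) ^ 2 := by
    intro w
    rw [norm_mul, sq]
    have h1 : ‖1 / 2 + w‖ ≤ 1 / 2 + ‖w‖ := (norm_add_le _ _).trans (by norm_num)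
    have h2 : ‖1 / 2 - w‖ ≤ 1 / 2 + ‖w‖ := (norm_sub_le _ _).trans (by norm_num)
    gcongr <;> linarith
  refine exists_norm_le_exp norm_xiZeta_neg_conj (C := 2 + C * 2 ^ (3 / 2 : ℝ))
    (D := |D| + 1) (fun w hw ↦ ?_) (fun w h0 h4 ↦ ?_)
  · have h1 : 1 + ‖w‖ ≤ (1 + ‖w‖) ^ (3 / 2 : ℝ) := by
      conv_lhs => rw [← Real.rpow_one (1 + ‖w‖)]
      exact Real.rpow_le_rpow_of_exponent_le (by linarith [norm_nonneg w]) (by norm_num)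
    have h2 : 1 / 2 + w ≠ 0 := fun h ↦ by
      have := congrArg re h
      rw [hre, zero_re] at this
      linarith
    have h3 : 1 / 2 - w ≠ 0 := fun h ↦ by
      have := congrArg re h
      norm_num at this
      linarith
    rw [xiZeta_eq h2 h3, norm_mul, add_mul (2 : ℝ), Real.exp_add,
      ← DirichletCharacter.completedLFunction_modOne_eq (χ := 1)]
    gcongr
    · refine (hpoly w).trans ?_
      rw [mul_comm, Real.exp_mul]
      norm_cast
      gcongr
      linarith [Real.add_one_le_exp ((1 + ‖w‖) ^ (3 / 2 : ℝ))]
    · refine (hC _ (by rw [hre]; linarith)).trans (Real.exp_le_exp.mpr ?_)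
      rw [mul_assoc, ← Real.mul_rpow (by norm_num) (by positivity)]
      gcongr
      have : ‖1 / 2 + w‖ ≤ 1 / 2 + ‖w‖ := (norm_add_le _ _).trans (by norm_num)
      linarith [norm_nonneg w]
  · have h1 : ‖completedRiemannZeta₀ (1 / 2 + w)‖ ≤ |D| := by
      rw [completedRiemannZeta₀, HurwitzZeta.completedHurwitzZetaEven₀, norm_div, norm_ofNat]
      have := hD ((1 / 2 + w) / 2) (by rw [div_ofNat_re, hre]; linarith)
        (by rw [div_ofNat_re, hre]; linarith)
      linarith [le_abs_self D, abs_nonneg D]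
    have h2 : 1 ≤ (1 + ‖w‖) ^ 2 := one_le_pow₀ (by linarith [norm_nonneg w])
    calc ‖xiZeta w‖ ≤ ‖(1 / 2 + w) * (1 / 2 - w) * completedRiemannZeta₀ (1 / 2 + w)‖ + ‖(1 : ℂ)‖ :=
          norm_sub_le _ _
      _ ≤ (1 + ‖w‖) ^ 2 * |D| + (1 + ‖w‖) ^ 2 := by
          rw [norm_mul, norm_one]
          gcongr
          exact hpoly w
      _ = _ := by ring

/-- The sum over zeros attached to the principal character converges. -/
theorem summable_zeroTerm_one (hGRH : GRH) (q : ℕ) [NeZero q] :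
    Summable fun γ : ordinates (1 : DirichletCharacter ℂ q) ↦
      zeroTerm (1 : DirichletCharacter ℂ q) γ := by
  obtain ⟨K, hK⟩ := exists_norm_xiZeta_le
  have hsum := hasSum_zeros differentiable_xiZeta
    (fun w hw ↦ re_eq_zero_of_xiZeta_eq_zero hGRH hw) norm_xiZeta_neg_conj hK
  have hne : ∀ w : ℂ, |w.re| < 1 / 2 → 1 / 2 - w ≠ 0 := fun w hw h ↦ by
    have := congrArg re h
    norm_num at this
    linarith [(abs_lt.mp hw).2]
  have hpos : ∀ w : ℂ, |w.re| < 1 / 2 → 0 < (1 / 2 + w).re := fun w hw ↦ by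
    rw [add_re]; norm_num; linarith [(abs_lt.mp hw).1]
  have hne' : ∀ w : ℂ, |w.re| < 1 / 2 → 1 / 2 + w ≠ 0 := fun w hw h ↦ by
    have := hpos w hw
    rw [h] at this; simp at this
  have habs : ∀ w : ℂ, w.re = 0 → |w.re| < 1 / 2 := fun w hw ↦ by rw [hw]; norm_num
  refine (hasSum_zeroTerm_of_eq_mul 1 (v := fun w ↦ (Gammaℝ (1 / 2 + w))⁻¹ *
    eulerFactors (1 : DirichletCharacter ℂ 1) q (1 / 2 + w) / ((1 / 2 + w) * (1 / 2 - w)))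
    differentiable_xiZeta (fun w hw ↦ ?_) (fun w hw ↦ ?_) (fun w hw ↦ ?_) hsum).summable
  · have hopen : {z : ℂ | |z.re| < 1 / 2} ∈ 𝓝 w :=
      (isOpen_lt (by fun_prop) continuous_const).mem_nhds (habs w hw)
    refine DifferentiableOn.analyticAt (s := {z : ℂ | |z.re| < 1 / 2}) (fun z hz ↦ ?_) hopen
    refine DifferentiableAt.differentiableWithinAt ?_
    have hg : DifferentiableAt ℂ (fun w ↦ (Gammaℝ (1 / 2 + w))⁻¹) z :=
      (differentiable_Gammaℝ_inv _).comp z (by fun_prop)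
    have he : DifferentiableAt ℂ (fun w ↦ eulerFactors (1 : DirichletCharacter ℂ 1) q (1 / 2 + w)) z :=
      ((differentiable_eulerFactors _ q) _).comp z (by fun_prop)
    exact (hg.mul he).div (by fun_prop) (mul_ne_zero (hne' z hz) (hne z hz))
  · exact div_ne_zero (mul_ne_zero (inv_ne_zero (Gammaℝ_ne_zero_of_re_pos (hpos w (habs w hw))))
      (eulerFactors_ne_zero _ q (hpos w (habs w hw))))
      (mul_ne_zero (hne' w (habs w hw)) (hne w (habs w hw)))
  · have h1 : 1 / 2 + w ≠ 1 := fun h ↦ hne w hw (by linear_combination -h)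
    have := DirichletCharacter.LFunction_changeLevel (N := q) (one_dvd q) (1 : DirichletCharacter ℂ 1)
      (s := 1 / 2 + w) (.inr h1)
    rw [map_one, DirichletCharacter.LFunction_modOne_eq] at this
    rw [this, xiZeta_eq_riemannZeta_mul (hpos w hw) (hne w hw), eulerFactors]
    have := Gammaℝ_ne_zero_of_re_pos (hpos w hw)
    have := hne w hw
    have := hne' w hw
    clear hsum hK
    generalize 1 / 2 + w = s at *
    generalize 1 / 2 - w = t at *
    field_simp

end CompletedLFunctions

/-! ### Divisor sums and orthogonality of characters -/

section ArithmeticSums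

open Finset

/-- A sum against the von Mangoldt function over divisors, as a sum over prime powers. -/
lemma sum_divisors_vonMangoldt_mul {q : ℕ} (hq : q ≠ 0) (F : ℕ → ℝ) :
    ∑ e ∈ q.divisors, Λ e * F e =
      ∑ p ∈ q.primeFactors, ∑ k ∈ Icc 1 (q.factorization p), Real.log p * F (p ^ k) := by
  rw [sum_sigma']
  symm
  refine sum_of_injOn (fun x ↦ x.1 ^ x.2) ?_ ?_ ?_ ?_
  · rintro ⟨p, k⟩ hx ⟨p', k'⟩ hx' h
    simp only [coe_sigma, Set.mem_sigma_iff, mem_coe, Nat.mem_primeFactors, mem_Icc] at hx hx' h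
    have hpp : p = p' := by
      have h1 : p ∣ p' ^ k' := h ▸ dvd_pow_self p (by omega)
      exact (Nat.prime_dvd_prime_iff_eq hx.1.1 hx'.1.1).mp (hx.1.1.dvd_of_dvd_pow h1)
    subst hpp
    have := Nat.pow_right_injective hx.1.1.two_le h
    subst this
    rfl
  · rintro ⟨p, k⟩ hx
    simp only [coe_sigma, Set.mem_sigma_iff, mem_coe, Nat.mem_primeFactors, mem_Icc] at hx
    simp only [mem_coe, Nat.mem_divisors]
    exact ⟨(hx.1.1.pow_dvd_iff_le_factorization hq).mpr hx.2.2, hq⟩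
  · intro e he hne
    by_cases hpp : IsPrimePow e
    · exfalso
      obtain ⟨p, k, hp, hk, rfl⟩ := (isPrimePow_nat_iff _).mp hpp
      refine hne ⟨⟨p, k⟩, ?_, rfl⟩
      have hd := (Nat.mem_divisors.mp he).1
      simp only [coe_sigma, Set.mem_sigma_iff, mem_coe, Nat.mem_primeFactors, mem_Icc]
      exact ⟨⟨hp, (dvd_pow_self p hk.ne').trans hd, hq⟩, hk,
        (hp.pow_dvd_iff_le_factorization hq).mp hd⟩
    · rw [ArithmeticFunction.vonMangoldt_eq_zero_iff.mpr hpp, zero_mul]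
  · rintro ⟨p, k⟩ hx
    simp only [mem_sigma, Nat.mem_primeFactors, mem_Icc] at hx
    rw [ArithmeticFunction.vonMangoldt_apply_pow (Nat.one_le_iff_ne_zero.mp hx.2.1),
      ArithmeticFunction.vonMangoldt_apply_prime hx.1.1]

/-- Write `q = p ^ v * h` with `h` prime to `p`. The sum is `φ(h) ∑_{i ≤ v - j} φ(p ^ i) = φ(h) p ^
(v - j)`, and `φ(p ^ v) = p ^ (v - j) φ(p ^ j)` because `j ≥ 1`. -/
lemma sum_totient_div_prime_pow {q p j : ℕ} (hq : q ≠ 0) (hp : p.Prime) (hj : 1 ≤ j)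
    (hjq : j ≤ q.factorization p) :
    ∑ k ∈ Icc j (q.factorization p), ((q / p ^ k).totient : ℝ) =
      q.totient / ((p ^ j).totient : ℝ) := by
  set v := q.factorization p with hv
  obtain ⟨h, hqh⟩ : p ^ v ∣ q := Nat.ordProj_dvd q p
  have hcop : Nat.Coprime p h := by
    have := Nat.coprime_ordCompl hp hq
    rwa [← hv, hqh, Nat.mul_div_cancel_left _ (pow_pos hp.pos _)] at this
  have hterm : ∀ k ∈ Icc j v, ((q / p ^ k).totient : ℝ) = ((p ^ (v - k)).totient : ℝ) * h.totient := by
    intro k hk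
    rw [mem_Icc] at hk
    have : q / p ^ k = p ^ (v - k) * h := by
      rw [hqh]
      refine Nat.div_eq_of_eq_mul_right (pow_pos hp.pos _) ?_
      rw [← mul_assoc, ← pow_add, Nat.add_sub_cancel' hk.2]
    rw [this, Nat.totient_mul (hcop.pow_left _)]
    push_cast
    rfl
  have hsum : ∑ k ∈ Icc j v, ((p ^ (v - k)).totient : ℝ) = (p : ℝ) ^ (v - j) := by
    have h1 : ∑ i ∈ range (v - j + 1), (p ^ i).totient = p ^ (v - j) := by
      rw [← Nat.sum_divisors_prime_pow (f := Nat.totient) hp, Nat.sum_totient]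
    have h2 : ∑ k ∈ Icc j v, (p ^ (v - k)).totient = ∑ i ∈ range (v - j + 1), (p ^ i).totient := by
      refine sum_nbij' (fun k ↦ v - k) (fun i ↦ v - i) ?_ ?_ ?_ ?_ ?_ <;>
        simp only [mem_Icc, mem_range] <;> intros <;> first | omega | trivial
    exact_mod_cast h2.trans h1
  have hφ : ((p ^ v).totient : ℝ) = (p : ℝ) ^ (v - j) * ((p ^ j).totient : ℝ) := by
    rw [Nat.totient_prime_pow hp (by omega), Nat.totient_prime_pow hp (by omega)]
    push_cast
    rw [← mul_assoc, ← pow_add]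
    congr 2
    omega
  have hpos : ((p ^ j).totient : ℝ) ≠ 0 := by
    exact_mod_cast (Nat.totient_pos.mpr (pow_pos hp.pos _)).ne'
  rw [sum_congr rfl hterm, ← sum_mul, hsum, eq_div_iff hpos]
  conv_rhs => rw [hqh]
  rw [Nat.totient_mul (hcop.pow_left _)]
  push_cast
  rw [hφ]
  ring

lemma sum_divisors_vonMangoldt_totient {q : ℕ} (hq : q ≠ 0) :
    ∑ d ∈ q.divisors, Λ (q / d) * (d.totient : ℝ) =
      q.totient * ∑ p ∈ q.primeFactors, Real.log p / ((p : ℝ) - 1) := by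
  have h1 : ∑ d ∈ q.divisors, Λ (q / d) * (d.totient : ℝ) =
      ∑ e ∈ q.divisors, Λ e * ((q / e).totient : ℝ) := by
    rw [← Nat.sum_div_divisors q (fun e ↦ Λ e * ((q / e).totient : ℝ))]
    refine sum_congr rfl fun d hd ↦ ?_
    rw [Nat.div_div_self (Nat.dvd_of_mem_divisors hd) hq]
  rw [h1, sum_divisors_vonMangoldt_mul hq (fun e ↦ ((q / e).totient : ℝ)), mul_sum]
  refine sum_congr rfl fun p hp ↦ ?_
  have hp' := Nat.prime_of_mem_primeFactors hp
  rw [← mul_sum, sum_totient_div_prime_pow hq hp' le_rfl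
    ((hp'.dvd_iff_one_le_factorization hq).mp (Nat.dvd_of_mem_primeFactors hp)), pow_one,
    Nat.totient_prime hp', Nat.cast_sub hp'.one_le]
  push_cast
  ring

/-- With `r = q/g` and `e = q/d`, the condition `d ∣ g` becomes `r ∣ e`. As `r ≠ 1`, a prime power
`e` divisible by `r` forces `r = p ^ j`, and then only the powers `p ^ k` with `k ≥ j` remain. If
`r` is not a prime power, both sides vanish. -/
lemma sum_divisors_vonMangoldt_totient_of_dvd {q g : ℕ} (hq : q ≠ 0) (hg : g ∣ q) (hne : g ≠ q) :
    ∑ d ∈ q.divisors with d ∣ g, Λ (q / d) * (d.totient : ℝ) =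
      q.totient * (Λ (q / g) / ((q / g).totient : ℝ)) := by
  obtain ⟨r, rfl⟩ := hg
  have hg0 : 0 < g := Nat.pos_of_ne_zero fun h ↦ hq (by simp [h])
  have hr0 : r ≠ 0 := fun h ↦ hq (by simp [h])
  have hr1 : r ≠ 1 := fun h ↦ hne (by simp [h])
  rw [Nat.mul_div_cancel_left _ hg0]
  set q := g * r with hqdef
  have h1 : ∑ d ∈ q.divisors with d ∣ g, Λ (q / d) * (d.totient : ℝ) =
      ∑ e ∈ q.divisors, Λ e * (if r ∣ e then ((q / e).totient : ℝ) else 0) := by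
    rw [← Nat.sum_div_divisors q
      (fun e ↦ Λ e * (if r ∣ e then ((q / e).totient : ℝ) else 0)), sum_filter]
    refine sum_congr rfl fun d hd ↦ ?_
    have hdq := Nat.dvd_of_mem_divisors hd
    have hiff : d ∣ g ↔ r ∣ q / d := by
      obtain ⟨e, he⟩ := hdq
      have hd0 : 0 < d := Nat.pos_of_mem_divisors hd
      rw [he, Nat.mul_div_cancel_left _ hd0]
      constructor
      · rintro ⟨c, rfl⟩
        refine ⟨c, Nat.eq_of_mul_eq_mul_left hd0 ?_⟩
        rw [← he, hqdef]; ring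
      · rintro ⟨c, rfl⟩
        refine ⟨c, Nat.eq_of_mul_eq_mul_right (Nat.pos_of_ne_zero hr0) ?_⟩
        rw [← hqdef, he]; ring
    rw [Nat.div_div_self hdq hq]
    simp only [hiff, mul_ite, mul_zero]
  rw [h1]
  by_cases hpp : IsPrimePow r
  · obtain ⟨p, j, hp, hj, rfl⟩ := (isPrimePow_nat_iff _).mp hpp
    have hpq : p ∈ q.primeFactors :=
      Nat.mem_primeFactors.mpr ⟨hp, (dvd_pow_self p hj.ne').trans (Dvd.intro_left g rfl), hq⟩
    have hjq : j ≤ q.factorization p :=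
      (hp.pow_dvd_iff_le_factorization hq).mp (Dvd.intro_left g rfl)
    rw [sum_divisors_vonMangoldt_mul hq, sum_eq_single p]
    · rw [← mul_sum]
      have h2 : ∑ k ∈ Icc 1 (q.factorization p),
          (if p ^ j ∣ p ^ k then ((q / p ^ k).totient : ℝ) else 0) =
          ∑ k ∈ Icc j (q.factorization p), ((q / p ^ k).totient : ℝ) := by
        rw [← sum_filter]
        refine sum_congr ?_ fun _ _ ↦ rfl
        ext k
        simp only [mem_filter, mem_Icc, Nat.pow_dvd_pow_iff_le_right hp.one_lt]
        omega
      rw [h2, sum_totient_div_prime_pow hq hp hj hjq,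
        ArithmeticFunction.vonMangoldt_apply_pow hj.ne', ArithmeticFunction.vonMangoldt_apply_prime hp]
      ring
    · intro p' hp' hne'
      refine sum_eq_zero fun k _ ↦ ?_
      rw [if_neg, mul_zero]
      intro hdvd
      have h3 : p ∣ p' ^ k := (dvd_pow_self p hj.ne').trans hdvd
      exact hne' ((Nat.prime_dvd_prime_iff_eq hp (Nat.prime_of_mem_primeFactors hp')).mp
        (hp.dvd_of_dvd_pow h3)).symm
    · intro h
      exact absurd hpq h
  · rw [ArithmeticFunction.vonMangoldt_eq_zero_iff.mpr hpp, zero_div, mul_zero]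
    refine sum_eq_zero fun e he ↦ ?_
    split_ifs with hre
    · rw [ArithmeticFunction.vonMangoldt_eq_zero_iff.mpr, zero_mul]
      intro hpe
      exact hpp (hpe.dvd hre hr1)
    · rw [mul_zero]

/-- This is `log (q/c) = ∑_{e ∣ q/c} Λ(e)` with `e = q/d`. It expresses the logarithm of a conductor
through the conditions `c ∣ d`, which orthogonality can sum. -/
lemma log_eq_log_sub_sum_vonMangoldt {q c : ℕ} (hq : q ≠ 0) (hc : c ∣ q) :
    Real.log c = Real.log q - ∑ d ∈ q.divisors with c ∣ d, Λ (q / d) := by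
  obtain ⟨r, hr⟩ := hc
  have hc0 : c ≠ 0 := fun h ↦ hq (by rw [hr, h, zero_mul])
  have hr0 : r ≠ 0 := fun h ↦ hq (by rw [hr, h, mul_zero])
  have h1 : ∑ d ∈ q.divisors with c ∣ d, Λ (q / d) = ∑ e ∈ r.divisors, Λ e := by
    refine sum_nbij' (fun d ↦ q / d) (fun e ↦ q / e) ?_ ?_ ?_ ?_ ?_
    · intro d hd
      simp only [mem_filter, Nat.mem_divisors] at hd
      obtain ⟨⟨⟨e, he⟩, _⟩, ⟨k, hk⟩⟩ := hd
      rw [Nat.mem_divisors]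
      refine ⟨?_, hr0⟩
      have hd0 : 0 < d := Nat.pos_of_ne_zero fun h ↦ hq (by rw [he, h, zero_mul])
      rw [he, Nat.mul_div_cancel_left _ hd0]
      refine ⟨k, Nat.eq_of_mul_eq_mul_left (Nat.pos_of_ne_zero hc0) ?_⟩
      rw [← hr, he, hk]; ring
    · intro e he
      simp only [mem_filter, Nat.mem_divisors] at he ⊢
      obtain ⟨⟨k, hk⟩, _⟩ := he
      have he0 : 0 < e := Nat.pos_of_ne_zero fun h ↦ hr0 (by rw [hk, h, zero_mul])
      have : q = e * (c * k) := by rw [hr, hk]; ring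
      exact ⟨⟨Nat.div_dvd_of_dvd ⟨_, this⟩, hq⟩, ⟨k, Nat.div_eq_of_eq_mul_right he0 this⟩⟩
    · intro d hd
      exact Nat.div_div_self (Nat.dvd_of_mem_divisors (mem_filter.mp hd).1) hq
    · intro e he
      exact Nat.div_div_self ((Nat.dvd_of_mem_divisors he).trans (Dvd.intro_left _ hr.symm)) hq
    · intro d _
      rfl
  rw [h1, ArithmeticFunction.vonMangoldt_sum, hr]
  push_cast
  rw [Real.log_mul (by exact_mod_cast hc0) (by exact_mod_cast hr0)]
  ring

lemma norm_sub_sq_eq {q : ℕ} (χ : DirichletCharacter ℂ q) (a b : (ZMod q)ˣ) :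
    ‖χ (a : ZMod q) - χ (b : ZMod q)‖ ^ 2 = 2 - 2 * (χ ((a * b⁻¹ : (ZMod q)ˣ) : ZMod q)).re := by
  have hb : χ (a : ZMod q) = χ ((a * b⁻¹ : (ZMod q)ˣ) : ZMod q) * χ (b : ZMod q) := by
    rw [← map_mul, ← Units.val_mul, inv_mul_cancel_right]
  have h1 : ‖χ ((a * b⁻¹ : (ZMod q)ˣ) : ZMod q)‖ = 1 := χ.unit_norm_eq_one _
  rw [hb, ← sub_one_mul, norm_mul, χ.unit_norm_eq_one, mul_one, Complex.sq_norm, Complex.normSq_apply]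
  have h2 := Complex.sq_norm (χ ((a * b⁻¹ : (ZMod q)ˣ) : ZMod q))
  rw [h1, Complex.normSq_apply] at h2
  simp only [Complex.sub_re, Complex.sub_im, Complex.one_re, Complex.one_im]
  linarith

section Characters

variable {q : ℕ} [NeZero q]

/-- Orthogonality for the characters whose conductor divides `d`. -/
lemma sum_apply_of_conductor_dvd {d : ℕ} (hd : d ∣ q) (u : (ZMod q)ˣ) :
    ∑ χ : DirichletCharacter ℂ q with χ.conductor ∣ d, χ u =
      if ZMod.unitsMap hd u = 1 then (d.totient : ℂ) else 0 := by
  classical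
  have : NeZero d := ⟨fun h ↦ NeZero.ne q (Nat.eq_zero_of_zero_dvd (h ▸ hd))⟩
  have h1 : ∑ ψ : DirichletCharacter ℂ d, ψ (ZMod.unitsMap hd u : (ZMod d)ˣ) =
      ∑ χ : DirichletCharacter ℂ q with χ.conductor ∣ d, χ u := by
    refine sum_bij (fun ψ _ ↦ DirichletCharacter.changeLevel hd ψ) ?_ ?_ ?_ ?_
    · intro ψ _
      rw [mem_filter]
      exact ⟨mem_univ _, DirichletCharacter.conductor_dvd_of_mem_conductorSet _
        (DirichletCharacter.changeLevel_factorsThrough ψ hd)⟩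
    · intro ψ _ ψ' _ h
      exact DirichletCharacter.changeLevel_injective hd h
    · intro χ hχ
      have hmem := (χ.mem_conductorSet_iff_conductor_dvd hd).mpr (mem_filter.mp hχ).2
      obtain ⟨_, ψ, hψ⟩ := hmem
      exact ⟨ψ, mem_univ _, hψ.symm⟩
    · intro ψ _
      rw [DirichletCharacter.changeLevel_eq_cast_of_dvd]
      rfl
  rw [← h1, DirichletCharacter.sum_characters_eq]
  simp only [Units.val_eq_one]

lemma sum_re_apply_of_conductor_dvd {d : ℕ} (hd : d ∣ q) (u : (ZMod q)ˣ) :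
    ∑ χ : DirichletCharacter ℂ q with χ.conductor ∣ d, (χ u).re =
      if ZMod.unitsMap hd u = 1 then (d.totient : ℝ) else 0 := by
  rw [← Complex.re_sum, sum_apply_of_conductor_dvd hd, apply_ite Complex.re, Complex.natCast_re,
    Complex.zero_re]

lemma sum_re_apply (u : (ZMod q)ˣ) :
    ∑ χ : DirichletCharacter ℂ q, (χ u).re = if u = 1 then (q.totient : ℝ) else 0 := by
  rw [← Complex.re_sum, DirichletCharacter.sum_characters_eq, apply_ite Complex.re,
    Complex.natCast_re, Complex.zero_re]
  simp only [Units.val_eq_one]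

/-- The origin of the gcd in `K`: orthogonality modulo `d` detects `a ≡ b` modulo `d`. -/
lemma unitsMap_mul_inv_eq_one_iff {d : ℕ} (hd : d ∣ q) (a b : (ZMod q)ˣ) :
    ZMod.unitsMap hd (a * b⁻¹) = 1 ↔ d ∣ Nat.gcd q ((a : ZMod q) - (b : ZMod q)).val := by
  rw [map_mul, map_inv, mul_inv_eq_one, Nat.dvd_gcd_iff, and_iff_right hd,
    ← ZMod.natCast_eq_zero_iff, ← Units.val_inj, ← sub_eq_zero]
  have h1 : ∀ x : ZMod q, ((x.val : ℕ) : ZMod d) = ZMod.castHom hd (ZMod d) x := fun x ↦ by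
    rw [ZMod.natCast_val, ZMod.castHom_apply]
  rw [h1, map_sub]
  rfl

variable {a b : (ZMod q)ˣ}

lemma sum_norm_sub_sq (hab : a ≠ b) :
    ∑ χ : DirichletCharacter ℂ q, ‖χ (a : ZMod q) - χ (b : ZMod q)‖ ^ 2 = 2 * q.totient := by
  simp_rw [norm_sub_sq_eq]
  rw [sum_sub_distrib, ← mul_sum, sum_re_apply, if_neg (by rwa [mul_inv_eq_one]), sum_const,
    card_univ, ← Nat.card_eq_fintype_card, DirichletCharacter.card_eq_totient_of_hasEnoughRootsOfUnity]
  rw [nsmul_eq_mul]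
  ring

/-- If `-1 = 1` then `q ∣ 2`, and the unit group is too small to contain two distinct classes. -/
lemma neg_one_units_ne_one (hab : a ≠ b) : (-1 : (ZMod q)ˣ) ≠ 1 := by
  intro h
  have h1 : (-1 : ZMod q) = 1 := by simpa using congrArg Units.val h
  have h2 : ((2 : ℕ) : ZMod q) = 0 := by
    push_cast
    linear_combination -h1
  rw [ZMod.natCast_eq_zero_iff, Nat.dvd_prime Nat.prime_two] at h2
  have h3 : Fintype.card (ZMod q)ˣ = 1 := by
    rw [ZMod.card_units_eq_totient]
    rcases h2 with rfl | rfl <;> rfl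
  have := Fintype.card_le_one_iff_subsingleton.mp h3.le
  exact hab (Subsingleton.elim _ _)

lemma sum_norm_sub_sq_mul_neg_one (hab : a ≠ b) :
    ∑ χ : DirichletCharacter ℂ q, ‖χ (a : ZMod q) - χ (b : ZMod q)‖ ^ 2 * (χ (-1)).re =
      -(2 * q.totient * iota q ((-(a * b⁻¹) : (ZMod q)ˣ) : ZMod q)) := by
  have h1 : ∀ χ : DirichletCharacter ℂ q, ‖χ (a : ZMod q) - χ (b : ZMod q)‖ ^ 2 * (χ (-1)).re =
      2 * (χ ((-1 : (ZMod q)ˣ) : ZMod q)).re -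
        2 * (χ ((-(a * b⁻¹) : (ZMod q)ˣ) : ZMod q)).re := by
    intro χ
    have h2 : χ ((-(a * b⁻¹) : (ZMod q)ˣ) : ZMod q) =
        χ (-1) * χ ((a * b⁻¹ : (ZMod q)ˣ) : ZMod q) := by
      rw [← map_mul, Units.val_neg, neg_one_mul]
    rw [norm_sub_sq_eq, h2, Units.val_neg, Units.val_one]
    rcases χ.even_or_odd with h | h
    · rw [show χ (-1) = 1 from h, one_mul, Complex.one_re]; ring
    · rw [show χ (-1) = -1 from h, neg_one_mul, Complex.neg_re, Complex.neg_re, Complex.one_re]; ring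
  simp_rw [h1]
  rw [sum_sub_distrib, ← mul_sum, ← mul_sum, sum_re_apply, sum_re_apply,
    if_neg (neg_one_units_ne_one hab), iota]
  simp only [Units.val_eq_one]
  split_ifs <;> ring

/-- Expand `log χ.conductor` over divisors `d` and exchange sums. The term `1` in the weight yields
the sum over primes; the term `χ(ab⁻¹)` keeps only `d ∣ g` and yields `Λ(q/g)/φ(q/g)`. The displayed
`Λ q / φ(q)` cancels against the one inside `K`. -/
lemma sum_norm_sub_sq_mul_log_conductor (hab : a ≠ b) :
    ∑ χ : DirichletCharacter ℂ q, ‖χ (a : ZMod q) - χ (b : ZMod q)‖ ^ 2 * Real.log χ.conductor =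
      2 * q.totient * (Real.log q - ∑ p ∈ q.primeFactors, Real.log p / ((p : ℝ) - 1) +
        Λ q / (q.totient : ℝ) + K q ((a : ZMod q) - (b : ZMod q))) := by
  classical
  have hq : q ≠ 0 := NeZero.ne q
  set g := Nat.gcd q ((a : ZMod q) - (b : ZMod q)).val with hg
  have hgne : g ≠ q := by
    intro h
    have h1 : q ∣ ((a : ZMod q) - (b : ZMod q)).val := by
      rw [← Nat.gcd_eq_left_iff_dvd]; exact h
    have h2 := Nat.eq_zero_of_dvd_of_lt h1 (ZMod.val_lt _)
    rw [ZMod.val_eq_zero, sub_eq_zero, Units.val_inj] at h2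
    exact hab h2
  have hinner : ∀ d ∈ q.divisors,
      ∑ χ : DirichletCharacter ℂ q with χ.conductor ∣ d, ‖χ (a : ZMod q) - χ (b : ZMod q)‖ ^ 2 =
        2 * d.totient - 2 * (if d ∣ g then (d.totient : ℝ) else 0) := by
    intro d hd
    have hdq := Nat.dvd_of_mem_divisors hd
    have h1 := sum_re_apply_of_conductor_dvd hdq (1 : (ZMod q)ˣ)
    rw [map_one, if_pos rfl] at h1
    have h2 := sum_re_apply_of_conductor_dvd hdq (a * b⁻¹)
    simp_rw [unitsMap_mul_inv_eq_one_iff hdq] at h2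
    rw [← h2, ← h1, mul_sum, mul_sum, ← sum_sub_distrib]
    refine sum_congr rfl fun χ _ ↦ ?_
    rw [norm_sub_sq_eq, Units.val_one, map_one, Complex.one_re]
    ring
  have h1 : ∑ χ : DirichletCharacter ℂ q,
      ‖χ (a : ZMod q) - χ (b : ZMod q)‖ ^ 2 * Real.log χ.conductor =
      2 * q.totient * Real.log q - ∑ d ∈ q.divisors, Λ (q / d) *
        (2 * d.totient - 2 * (if d ∣ g then (d.totient : ℝ) else 0)) := by
    simp_rw [fun χ : DirichletCharacter ℂ q ↦
      log_eq_log_sub_sum_vonMangoldt hq χ.conductor_dvd_level, mul_sub]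
    rw [sum_sub_distrib, ← sum_mul, sum_norm_sub_sq hab]
    congr 1
    simp_rw [mul_sum, sum_filter]
    rw [sum_comm]
    refine sum_congr rfl fun d hd ↦ ?_
    rw [← mul_sub, ← hinner d hd, mul_sum, sum_filter]
    refine sum_congr rfl fun χ _ ↦ ?_
    split_ifs <;> ring
  have h2 : ∑ d ∈ q.divisors, Λ (q / d) * (2 * d.totient - 2 * (if d ∣ g then (d.totient : ℝ) else 0)) =
      2 * ∑ d ∈ q.divisors, Λ (q / d) * (d.totient : ℝ) -
      2 * ∑ d ∈ q.divisors with d ∣ g, Λ (q / d) * (d.totient : ℝ) := by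
    rw [sum_filter, mul_sum, mul_sum, ← sum_sub_distrib]
    refine sum_congr rfl fun d _ ↦ ?_
    split_ifs <;> ring
  rw [h1, h2, sum_divisors_vonMangoldt_totient hq,
    sum_divisors_vonMangoldt_totient_of_dvd hq (Nat.gcd_dvd_left _ _) hgne, K]
  ring

end Characters

end ArithmeticSums

/-! ### Reality of `M*` and assembly -/

section Main

open Complex ComplexConjugate Finset

lemma norm_inv_sub_inv {q : ℕ} (χ : DirichletCharacter ℂ q) (a b : ZMod q) :
    ‖χ⁻¹ a - χ⁻¹ b‖ = ‖χ a - χ b‖ := by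
  rw [← MulChar.star_apply', ← MulChar.star_apply', ← star_sub, norm_star]

section LogDerivatives

variable {q : ℕ} [NeZero q]

/-- Needed because the conductors of `χ` and `χ⁻¹` are equal only propositionally, so their
primitive characters have different types. -/
lemma LFunction_eq_of_level_eq {d d' : ℕ} [NeZero d] [NeZero d'] (hdd : d = d') (hd : d ∣ q)
    (hd' : d' ∣ q) {ψ : DirichletCharacter ℂ d} {ψ' : DirichletCharacter ℂ d'}
    (h : DirichletCharacter.changeLevel hd ψ = DirichletCharacter.changeLevel hd' ψ') :
    ψ.LFunction = ψ'.LFunction := by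
  subst hdd
  rw [DirichletCharacter.changeLevel_injective hd h]

lemma LFunction_primitiveCharacter_inv (χ : DirichletCharacter ℂ q) :
    χ⁻¹.primitiveCharacter.LFunction = (χ.primitiveCharacter)⁻¹.LFunction := by
  refine LFunction_eq_of_level_eq χ.conductor_inv χ⁻¹.conductor_dvd_level χ.conductor_dvd_level ?_
  rw [χ⁻¹.changeLevel_primitiveCharacter, map_inv, χ.changeLevel_primitiveCharacter]

lemma deriv_LFunction_inv_one {ψ : DirichletCharacter ℂ q} (hψ : ψ ≠ 1) :
    deriv ψ⁻¹.LFunction 1 = conj (deriv ψ.LFunction 1) := by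
  have h1 : ψ⁻¹.LFunction = conj ∘ ψ.LFunction ∘ conj := funext fun s ↦ by
    have := LFunction_inv_conj hψ (conj s)
    simpa using this
  have h2 := (DirichletCharacter.differentiable_LFunction hψ 1).hasDerivAt.conj_conj
  rw [map_one, ← h1] at h2
  exact h2.deriv

lemma conj_logDeriv_primitiveCharacter {χ : DirichletCharacter ℂ q} (hχ : χ ≠ 1) :
    conj (deriv χ.primitiveCharacter.LFunction 1 / χ.primitiveCharacter.LFunction 1) =
      deriv χ⁻¹.primitiveCharacter.LFunction 1 / χ⁻¹.primitiveCharacter.LFunction 1 := by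
  have hψ := primitiveCharacter_ne_one hχ
  have h1 := LFunction_inv_conj hψ 1
  rw [map_one] at h1
  rw [LFunction_primitiveCharacter_inv, deriv_LFunction_inv_one hψ, h1, map_div₀]

/-- The substitution `χ ↦ χ⁻¹` conjugates `L'/L(1, χ*)` and preserves the weights. -/
lemma conj_MStar (a b : (ZMod q)ˣ) : conj (MStar q a b) = MStar q a b := by
  classical
  rw [MStar, map_sum]
  refine sum_equiv (Equiv.inv _) (fun χ ↦ by simp) fun χ hχ ↦ ?_
  rw [Finset.mem_filter] at hχ
  rw [map_mul, conj_ofReal, conj_logDeriv_primitiveCharacter hχ.2, Equiv.inv_apply, norm_inv_sub_inv]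

lemma re_MStar (a b : (ZMod q)ˣ) :
    (MStar q a b).re = ∑ χ : DirichletCharacter ℂ q, ‖χ (a : ZMod q) - χ (b : ZMod q)‖ ^ 2 *
      (deriv χ.primitiveCharacter.LFunction 1 / χ.primitiveCharacter.LFunction 1).re := by
  classical
  rw [MStar, re_sum, sum_filter]
  refine sum_congr rfl fun χ _ ↦ ?_
  split_ifs with h
  · rw [re_ofReal_mul]
  -- The principal character may be included: its weight is zero.
  · rw [not_not] at h
    subst h
    simp

end LogDerivatives

end Main

end PrimeRace

theorem mainTheorem2 (hGRH : PrimeRace.GRH) (q : ℕ) [NeZero q] (a b : (ZMod q)ˣ) (hab : a ≠ b) :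
    (∀ χ : DirichletCharacter ℂ q,
      Summable fun γ : PrimeRace.ordinates χ => PrimeRace.zeroTerm χ γ) ∧
    (PrimeRace.variance q a b : ℂ) =
      ((2 * (Nat.totient q : ℝ) *
        (PrimeRace.calL q + PrimeRace.K q ((a : ZMod q) - (b : ZMod q)) +
          PrimeRace.iota q ((-(a * b⁻¹) : (ZMod q)ˣ) : ZMod q) * Real.log 2) : ℝ) : ℂ) +
      2 * PrimeRace.MStar q a b := by
  open PrimeRace in
  refine ⟨fun χ ↦ ?_, ?_⟩
  · by_cases hχ : χ = 1
    · subst hχ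
      exact summable_zeroTerm_one hGRH q
    · exact (hasSum_zeroTerm_of_ne_one hGRH hχ).summable
  have hM : (MStar q a b : ℂ) = ((MStar q a b).re : ℂ) :=
    (Complex.conj_eq_iff_re.mp (conj_MStar a b)).symm
  rw [hM]
  norm_cast
  -- Valid for the principal character too, since every term carries its zero weight.
  have hterm : ∀ χ : DirichletCharacter ℂ q,
      ‖χ (b : ZMod q) - χ (a : ZMod q)‖ ^ 2 * bSum χ =
      ‖χ (a : ZMod q) - χ (b : ZMod q)‖ ^ 2 * Real.log χ.conductor -
        ‖χ (a : ZMod q) - χ (b : ZMod q)‖ ^ 2 *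
          (Real.eulerMascheroniConstant + Real.log Real.pi + Real.log 2) -
        ‖χ (a : ZMod q) - χ (b : ZMod q)‖ ^ 2 * (χ (-1)).re * Real.log 2 +
        2 * (‖χ (a : ZMod q) - χ (b : ZMod q)‖ ^ 2 *
          (deriv χ.primitiveCharacter.LFunction 1 / χ.primitiveCharacter.LFunction 1).re) := by
    intro χ
    rw [norm_sub_rev]
    by_cases hχ : χ = 1
    · subst hχ
      simp
    · rw [bSum, (hasSum_zeroTerm_of_ne_one hGRH hχ).tsum_eq]
      ring
  rw [variance, Finset.sum_congr rfl fun χ _ ↦ hterm χ, Finset.sum_add_distrib,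
    Finset.sum_sub_distrib, Finset.sum_sub_distrib, ← Finset.sum_mul, ← Finset.sum_mul,
    ← Finset.mul_sum, ← re_MStar, sum_norm_sub_sq_mul_log_conductor hab, sum_norm_sub_sq hab,
    sum_norm_sub_sq_mul_neg_one hab, calL, Real.log_mul two_ne_zero Real.pi_ne_zero]
  push_cast
  ring
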